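/- Let $K$ be a field, let $n,r$ be positive integers, let $q,Q_1,\dots,Q_r\in K^\times$, and let $\mathcal H_n=\mathcal H_{n,r}(q;Q_1,\dots,Q_r)$ be the Ariki–Koike algebra, i.e. the unital associative $K$-algebra with generators $T_0,\dots,T_{n-1}$ and relations $$(T_0-Q_1)\cdots(T_0-Q_r)=0,\quad (T_i-q)(T_i+1)=0\ (1\le i\le n-1),\quad T_0T_1T_0T_1=T_1T_0T_1T_0,$$ $$T_iT_{i+1}T_i=T_{i+1}T_iT_{i+1}\ (1\le i\le n-2),\qquad T_iT_j=T_jT_i\ (|i-j|>1).$$ Modules are right modules. Let $\operatorname{ind}_n(M)=M\otimes_{\mathcal H_n}\mathcal H_{n+1}$ be induction along $\mathcal H_n\to\mathcal H_{n+1}$, $T_i\mapsto T_i$. Let $L_1=T_0$ and $L_{k+1}=q^{-1}T_kL_kT_k$. For an $r$-multipartition $\lambda=(\lambda^{(1)},\dots,\lambda^{(r)})$ of $n$ let $x_\lambda$ be the sum of $T_w$ over the row stabilizer of the initial tableau of shape $\lambda$, let $m_\lambda=\prod_{s=1}^{r}\prod_{k=1}^{|\lambda^{(1)}|+\dots+|\lambda^{(s-1)}|}(L_k-Q_s)\cdot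 x_\lambda$, and let $\mathcal H^\lambda$ be the two-sided ideal generated by the $m_\mu$ for the $r$-multipartitions $\mu$ of $n$ that strictly dominate $\lambda$. The Specht module $S^\lambda$ is the right submodule of $\mathcal H_n/\mathcal H^\lambda$ generated by the class of $m_\lambda$, and $D^\lambda=S^\lambda/\operatorname{rad}S^\lambda$, where the radical is that of the bilinear form determined by $\langle m_\lambda a,m_\lambda b\rangle\, m_\lambda\equiv m_\lambda a\,b^*m_\lambda \pmod{\mathcal H^\lambda}$, and $*$ is the anti-automorphism of $\mathcal H_n$ fixing every $T_i$. For a partition $\alpha$ of $n$ let $D^\alpha$ be the right module of the group algebra $K[S_n]$ defined in the same way: $x_\alpha$ is the sum of the row stabilizer of the initial tableau of shape $\alpha$, the ideal is generated by the $x_\beta$ with $\beta$ strictly dominating $\alpha$, $S^\alpha$ is generated by the class of $x_\alpha$, $*$ is inversion of permutations, and $D^\alpha$ is the quotient of $S^\alpha$ by the radical of its form. Suppose that $q=1$ and that $(Q_1,\dots,Q_r)$ is $q$-connected (for all $i,j$ there is an integer $k$ with $Q_i=q^kQ_j$; as $q=1$, all $Q_i$ are equal). Let $\lambda=(\emptyset,\dots,\emptyset,\lambda^{(r)})$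 be an $r$-multipartition of $n$ with $D^\lambda\ne0$, and suppose that the $K[S_{n+1}]$-module $\operatorname{ind}_{K[S_n]}^{K[S_{n+1}]}D^{\lambda^{(r)}}$ has exactly $t\in\mathbb N$ composition factors (counted with multiplicity). Then $\operatorname{ind}_n(D^\lambda)$ has exactly $rt$ composition factors (counted with multiplicity). Moreover there is a strictly decreasing chain of $\mathcal H_{n+1}$-submodules $\operatorname{ind}_n(D^\lambda)=M_0\supsetneq M_1\supsetneq\dots\supsetneq M_r=0$ whose layers $M_\ell/M_{\ell+1}$, $0\le\ell<r$, are pairwise isomorphic and have exactly $t$ composition factors each. -/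

import Mathlib

open scoped TensorProduct

/-!
Conventions.  A right module over a ring `A` is a (left) module over `Aᵐᵒᵖ`; the action of `a` on
`x` from the right is `MulOpposite.op a • x`.
-/

/-! ### Induction of modules along a ring homomorphism -/

/-- The balancing relations `s f(a) ⊗ x - s ⊗ a x` in `S ⊗ M`, as a left `S`-submodule. -/
def balancedRel {R S : Type*} [Ring R] [Ring S] (f : R →+* S)
    (M : Type*) [AddCommGroup M] [Module R M] : Submodule S (S ⊗[ℤ] M) :=
  Submodule.span S {z | ∃ (s : S) (a : R) (x : M), z = (s * f a) ⊗ₜ[ℤ] x - s ⊗ₜ[ℤ] (a • x)}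

/-- The induced left `S`-module `S ⊗_R M` of a left `R`-module `M` along `f : R →+* S`. -/
abbrev InducedModule {R S : Type*} [Ring R] [Ring S] (f : R →+* S)
    (M : Type*) [AddCommGroup M] [Module R M] : Type _ :=
  (S ⊗[ℤ] M) ⧸ balancedRel f M

/-- The induced right `B`-module `M ⊗_A B` of a right `A`-module `M` along `f : A →+* B`: it is the
left `Bᵐᵒᵖ`-module `Bᵐᵒᵖ ⊗_{Aᵐᵒᵖ} M`, in which `x a ⊗ b = x ⊗ f(a) b`. -/
abbrev RightInduced {A B : Type*} [Ring A] [Ring B] (f : A →+* B)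
    (M : Type*) [AddCommGroup M] [Module Aᵐᵒᵖ M] : Type _ :=
  InducedModule (RingHom.op f) M

/-! ### Cell modules

Let `A` be a `K`-algebra with an anti-automorphism `star`, let `m : A` be the generator attached to
a shape and let `X` be the set of the generators attached to the strictly more dominant shapes. -/

section Cell

variable {K A : Type*} [Field K] [Ring A] [Algebra K A]

/-- The two-sided ideal of `A` generated by `X`, regarded as a right `A`-submodule of `A`. -/
def cellIdeal (X : Set A) : Submodule Aᵐᵒᵖ A :=
  Submodule.span Aᵐᵒᵖ {z | ∃ a : A, ∃ y ∈ X, z = a * y}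

/-- The Specht (cell) module: the right `A`-submodule of `A / I` generated by the class of `m`,
where `I` is the two-sided ideal generated by `X`. -/
def cellModule (m : A) (X : Set A) : Submodule Aᵐᵒᵖ (A ⧸ cellIdeal X) :=
  Submodule.span Aᵐᵒᵖ {(cellIdeal X).mkQ m}

/-- `CellFormEq star m X x y c` says that the cellular bilinear form takes the value `c` at
`(x, y)`.  The form is determined by the congruence `⟨m a, m b⟩ m ≡ (m a) (m b)^* = m a b^* m`
modulo the ideal generated by `X` (note `m^* = m`). -/
def CellFormEq (star : A →ₐ[K] Aᵐᵒᵖ) (m : A) (X : Set A) (x y : A ⧸ cellIdeal X) (c : K) : Prop :=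
  ∀ b : A, y = (cellIdeal X).mkQ (m * b) →
    MulOpposite.op ((star b).unop * m) • x = (cellIdeal X).mkQ (c • m)

/-- The radical of the cellular form: all `x` in the Specht module with `⟨x, y⟩ = 0` for every `y`
in the Specht module. -/
def cellRadical (star : A →ₐ[K] Aᵐᵒᵖ) (hstar : Function.Surjective star) (m : A) (X : Set A) :
    Submodule Aᵐᵒᵖ (cellModule m X) where
  carrier := {x | ∀ y ∈ cellModule m X, CellFormEq star m X x.1 y 0}
  zero_mem' := by
    intro y _ b _
    simp
  add_mem' := by
    intro x x' hx hx' y hy b hb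
    have h1 := hx y hy b hb
    have h2 := hx' y hy b hb
    simp only [zero_smul, map_zero] at h1 h2 ⊢
    rw [Submodule.coe_add, smul_add, h1, h2, add_zero]
  smul_mem' := by
    intro a x hx y hy b hb
    obtain ⟨d, hd⟩ := hstar (MulOpposite.op (a.unop * (star b).unop))
    have hmem : (cellIdeal X).mkQ (m * d) ∈ cellModule m X := by
      have : (cellIdeal X).mkQ (m * d) = MulOpposite.op d • (cellIdeal X).mkQ m := by
        rw [← map_smul]; rfl
      rw [this]
      exact Submodule.smul_mem _ _ (Submodule.subset_span rfl)
    have h := hx _ hmem d rfl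
    simp only [zero_smul, map_zero] at h ⊢
    rw [hd] at h
    rw [Submodule.coe_smul, smul_smul, ← h]
    congr 1
    apply MulOpposite.unop_injective
    simp [mul_assoc]

/-- The quotient of the Specht module by the radical of its bilinear form. -/
abbrev cellHead (star : A →ₐ[K] Aᵐᵒᵖ) (hstar : Function.Surjective star) (m : A) (X : Set A) :
    Type _ :=
  cellModule m X ⧸ cellRadical star hstar m X

end Cell

/-! ### Partitions and multipartitions -/

/-- Partitions of `n`, as Young diagrams. -/
abbrev YPartition (n : ℕ) : Type := {α : YoungDiagram // α.card = n}

/-- `r`-multipartitions of `n`. -/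
abbrev Multipartition (r n : ℕ) : Type := {lam : Fin r → YoungDiagram // ∑ i, (lam i).card = n}

/-- The sum of the lengths of the first `j` rows of `α`. -/
def rowSum (α : YoungDiagram) (j : ℕ) : ℕ := ∑ i ∈ Finset.range j, α.rowLen i

/-- Dominance order on Young diagrams (of the same size): `α` dominates `β`. -/
def Dominates (α β : YoungDiagram) : Prop := ∀ j, rowSum β j ≤ rowSum α j

/-- The number `a_s = |λ⁽¹⁾| + ⋯ + |λ⁽ˢ⁻¹⁾|` of boxes in the components before the `s`-th. -/
def boxesBefore {r : ℕ} (lam : Fin r → YoungDiagram) (s : Fin r) : ℕ :=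
  ∑ i ∈ Finset.univ.filter (· < s), (lam i).card

/-- Dominance order on multipartitions (of the same size): `lam` dominates `mu`. -/
def MultiDominates {r : ℕ} (lam mu : Fin r → YoungDiagram) : Prop :=
  ∀ s j, boxesBefore mu s + rowSum (mu s) j ≤ boxesBefore lam s + rowSum (lam s) j

/-- `k` (counted from `0`) lies in row `i` of the initial tableau of shape `α`, in which the boxes
are numbered along successive rows. -/
def InRow (α : YoungDiagram) (i k : ℕ) : Prop := rowSum α i ≤ k ∧ k < rowSum α (i + 1)

/-- `k` lies in row `i` of component `s` of the initial tableau of shape `lam`, in which the boxes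
are numbered along successive rows of the first, second, … component. -/
def InMultiRow {r : ℕ} (lam : Fin r → YoungDiagram) (s : Fin r) (i k : ℕ) : Prop :=
  boxesBefore lam s + rowSum (lam s) i ≤ k ∧ k < boxesBefore lam s + rowSum (lam s) (i + 1)

/-- The row stabilizer of the initial tableau of shape `α`. -/
noncomputable def rowStab {n : ℕ} (α : YPartition n) : Finset (Equiv.Perm (Fin n)) :=
  open Classical in
  Finset.univ.filter fun w => ∀ (i : ℕ) (k : Fin n), InRow α.1 i k → InRow α.1 i (w k)

/-- The row stabilizer of the initial tableau of shape `lam`. -/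
noncomputable def multiRowStab {r n : ℕ} (lam : Multipartition r n) : Finset (Equiv.Perm (Fin n)) :=
  open Classical in
  Finset.univ.filter fun w =>
    ∀ (s : Fin r) (i : ℕ) (k : Fin n), InMultiRow lam.1 s i k → InMultiRow lam.1 s i (w k)

/-! ### Ariki-Koike algebras -/

/-- A family of invertible parameters is `q`-connected if any two of its members differ by an
integral power of `q`. -/
def QConnected {K : Type*} [Field K] (q : Kˣ) {r : ℕ} (Q : Fin r → Kˣ) : Prop :=
  ∀ i j, ∃ k : ℤ, Q i = q ^ k * Q j

namespace ArikiKoike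

variable {K : Type*} [Field K] {r : ℕ} (q : Kˣ) (Q : Fin r → Kˣ)

/-- The defining relations of the Ariki-Koike algebra on the free algebra in `T_0, …, T_{n-1}`. -/
inductive Relation (n : ℕ) : FreeAlgebra K (Fin n) → FreeAlgebra K (Fin n) → Prop
  | cyclotomic (h : 0 < n) :
      Relation n ((List.finRange r).map fun j =>
        FreeAlgebra.ι K (⟨0, h⟩ : Fin n) - algebraMap K _ (Q j : K)).prod 0
  | quadratic (i : Fin n) (h : 0 < i.val) :
      Relation n ((FreeAlgebra.ι K i - algebraMap K _ (q : K)) * (FreeAlgebra.ι K i + 1)) 0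
  | braidFour (i j : Fin n) (hi : i.val = 0) (hj : j.val = 1) :
      Relation n
        (FreeAlgebra.ι K i * FreeAlgebra.ι K j * FreeAlgebra.ι K i * FreeAlgebra.ι K j)
        (FreeAlgebra.ι K j * FreeAlgebra.ι K i * FreeAlgebra.ι K j * FreeAlgebra.ι K i)
  | braidThree (i j : Fin n) (hi : 0 < i.val) (hj : j.val = i.val + 1) :
      Relation n
        (FreeAlgebra.ι K i * FreeAlgebra.ι K j * FreeAlgebra.ι K i)
        (FreeAlgebra.ι K j * FreeAlgebra.ι K i * FreeAlgebra.ι K j)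
  | comm (i j : Fin n) (h : i.val + 1 < j.val) :
      Relation n (FreeAlgebra.ι K i * FreeAlgebra.ι K j) (FreeAlgebra.ι K j * FreeAlgebra.ι K i)

end ArikiKoike

/-- The Ariki-Koike algebra `H_{n,r}(q; Q_1, …, Q_r)`. -/
def ArikiKoike {K : Type*} [Field K] {r : ℕ} (q : Kˣ) (Q : Fin r → Kˣ) (n : ℕ) : Type _ :=
  RingQuot (ArikiKoike.Relation q Q n)

namespace ArikiKoike

variable {K : Type*} [Field K] {r : ℕ} (q : Kˣ) (Q : Fin r → Kˣ)

instance (n : ℕ) : Ring (ArikiKoike q Q n) :=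
  inferInstanceAs (Ring (RingQuot (ArikiKoike.Relation q Q n)))

instance (n : ℕ) : Algebra K (ArikiKoike q Q n) :=
  inferInstanceAs (Algebra K (RingQuot (ArikiKoike.Relation q Q n)))

/-- The quotient map from the free algebra. -/
def mk (n : ℕ) : FreeAlgebra K (Fin n) →ₐ[K] ArikiKoike q Q n :=
  RingQuot.mkAlgHom K (ArikiKoike.Relation q Q n)

/-- The generators `T_0, …, T_{n-1}`. -/
def T {n : ℕ} (i : Fin n) : ArikiKoike q Q n := mk q Q n (FreeAlgebra.ι K i)

/-- The universal property of the presentation. -/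
noncomputable def lift {n : ℕ} {B : Type*} [Ring B] [Algebra K B] (t : Fin n → B)
    (h : ∀ x y, Relation q Q n x y → FreeAlgebra.lift K t x = FreeAlgebra.lift K t y) :
    ArikiKoike q Q n →ₐ[K] B :=
  RingQuot.liftAlgHom K ⟨FreeAlgebra.lift K t, h⟩

theorem lift_T {n : ℕ} {B : Type*} [Ring B] [Algebra K B] (t : Fin n → B)
    (h : ∀ x y, Relation q Q n x y → FreeAlgebra.lift K t x = FreeAlgebra.lift K t y) (i : Fin n) :
    lift q Q t h (T q Q i) = t i := by
  have := RingQuot.liftAlgHom_mkAlgHom_apply K (FreeAlgebra.lift K t)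
    (s := Relation q Q n) h (FreeAlgebra.ι K i)
  rw [FreeAlgebra.lift_ι_apply] at this
  exact this

theorem mk_eq {n : ℕ} {x y : FreeAlgebra K (Fin n)} (h : Relation q Q n x y) :
    mk q Q n x = mk q Q n y :=
  RingQuot.mkAlgHom_rel K h

theorem mk_ι {n : ℕ} (i : Fin n) : mk q Q n (FreeAlgebra.ι K i) = T q Q i := rfl

theorem lift_T_eq_mk (n : ℕ) : FreeAlgebra.lift K (fun i : Fin n => T q Q i) = mk q Q n := by
  ext i
  simp [mk_ι]

/-- The embedding `H_n → H_{n+1}`, `T_i ↦ T_i`. -/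
noncomputable def incl (n : ℕ) : ArikiKoike q Q n →ₐ[K] ArikiKoike q Q (n + 1) :=
  lift q Q (fun i => T q Q i.castSucc) (by
    intro x y h
    cases h with
    | cyclotomic h0 =>
      have := mk_eq q Q (Relation.cyclotomic (q := q) (Q := Q) (n := n + 1) (Nat.succ_pos n))
      simpa [map_list_prod, Function.comp_def, mk_ι, List.map_map] using this
    | quadratic i h0 =>
      have := mk_eq q Q (Relation.quadratic (q := q) (Q := Q) i.castSucc h0)
      simpa [mk_ι] using this
    | braidFour i j hi hj =>
      have := mk_eq q Q (Relation.braidFour (q := q) (Q := Q) i.castSucc j.castSucc hi hj)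
      simpa [mk_ι] using this
    | braidThree i j hi hj =>
      have := mk_eq q Q (Relation.braidThree (q := q) (Q := Q) i.castSucc j.castSucc hi hj)
      simpa [mk_ι] using this
    | comm i j hij =>
      have := mk_eq q Q (Relation.comm (q := q) (Q := Q) i.castSucc j.castSucc hij)
      simpa [mk_ι] using this)

/-- The anti-automorphism `*` of `H_n` with `T_i^* = T_i`. -/
noncomputable def star (n : ℕ) : ArikiKoike q Q n →ₐ[K] (ArikiKoike q Q n)ᵐᵒᵖ :=
  lift q Q (fun i => MulOpposite.op (T q Q i)) (by
    intro x y h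
    cases h with
    | cyclotomic h0 =>
      have h1 := mk_eq q Q (Relation.cyclotomic (q := q) (Q := Q) h0)
      have h2 : ∀ l : List (Fin r),
          Commute (mk q Q n (l.map fun j =>
            FreeAlgebra.ι K (⟨0, h0⟩ : Fin n) - algebraMap K _ (Q j : K)).prod)
              (T q Q ⟨0, h0⟩) ∧
          FreeAlgebra.lift K (fun i : Fin n => MulOpposite.op (T q Q i)) (l.map fun j =>
            FreeAlgebra.ι K (⟨0, h0⟩ : Fin n) - algebraMap K _ (Q j : K)).prod =
          MulOpposite.op (mk q Q n (l.map fun j =>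
            FreeAlgebra.ι K (⟨0, h0⟩ : Fin n) - algebraMap K _ (Q j : K)).prod) := by
        intro l
        induction l with
        | nil => exact ⟨by simp, by simp⟩
        | cons j l ih =>
          obtain ⟨ih1, ih2⟩ := ih
          have hc : Commute (algebraMap K (ArikiKoike q Q n) (Q j : K)) (T q Q ⟨0, h0⟩) :=
            Algebra.commutes _ _
          have hc' : ∀ z : ArikiKoike q Q n,
              Commute z (algebraMap K (ArikiKoike q Q n) (Q j : K)) :=
            fun z => (Algebra.commutes _ _).symm
          refine ⟨?_, ?_⟩
          · simp only [List.map_cons, List.prod_cons, map_mul, map_sub, mk_ι, AlgHom.commutes]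
            exact ((Commute.refl _).sub_left hc).mul_left ih1
          · simp only [List.map_cons, List.prod_cons, map_mul, map_sub, mk_ι, AlgHom.commutes,
              ih2, FreeAlgebra.lift_ι_apply]
            rw [(((Commute.sub_right ih1 (hc' _)).eq.symm) :
              (T q Q ⟨0, h0⟩ - algebraMap K (ArikiKoike q Q n) (Q j : K)) * _ = _)]
            simp [MulOpposite.algebraMap_apply]
      rw [(h2 _).2, h1]
      simp
    | quadratic i h0 =>
      have := mk_eq q Q (Relation.quadratic (q := q) (Q := Q) i h0)
      have hc : Commute (T q Q i - algebraMap K (ArikiKoike q Q n) (q : K)) (T q Q i + 1) :=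
        
        (((Commute.refl (T q Q i)).sub_left
          (Algebra.commutes (q : K) (T q Q i) :
            Commute (algebraMap K (ArikiKoike q Q n) (q : K)) (T q Q i))).add_right
          (Commute.one_right _))
      simp only [map_mul, map_sub, map_add, mk_ι, AlgHom.commutes, map_one, map_zero,
        FreeAlgebra.lift_ι_apply] at this ⊢
      rw [hc.eq] at this
      apply MulOpposite.unop_injective
      simpa [MulOpposite.algebraMap_apply] using this
    | braidFour i j hi hj =>
      have := mk_eq q Q (Relation.braidFour (q := q) (Q := Q) i j hi hj)
      apply MulOpposite.unop_injective
      simpa [mk_ι, mul_assoc] using this.symm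
    | braidThree i j hi hj =>
      have := mk_eq q Q (Relation.braidThree (q := q) (Q := Q) i j hi hj)
      apply MulOpposite.unop_injective
      simpa [mk_ι, mul_assoc] using this
    | comm i j hij =>
      have := mk_eq q Q (Relation.comm (q := q) (Q := Q) i j hij)
      apply MulOpposite.unop_injective
      simpa [mk_ι, mul_assoc] using this.symm)

theorem star_T {n : ℕ} (i : Fin n) : star q Q n (T q Q i) = MulOpposite.op (T q Q i) :=
  lift_T ..

theorem star_surjective (n : ℕ) : Function.Surjective (star q Q n) := by
  have key : ∀ x : FreeAlgebra K (Fin n),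
      MulOpposite.op (mk q Q n x) ∈ (star q Q n).range := by
    intro x
    induction x using FreeAlgebra.induction with
    | grade0 c =>
      refine ⟨algebraMap K _ c, ?_⟩
      simp [MulOpposite.algebraMap_apply]
    | grade1 i => exact ⟨T q Q i, star_T q Q i⟩
    | mul a b ha hb =>
      rw [map_mul, MulOpposite.op_mul]
      exact mul_mem hb ha
    | add a b ha hb =>
      rw [map_add, MulOpposite.op_add]
      exact add_mem ha hb
  intro y
  obtain ⟨x, hx⟩ := RingQuot.mkAlgHom_surjective K (Relation q Q n) y.unop
  obtain ⟨z, hz⟩ := key x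
  refine ⟨z, ?_⟩
  apply MulOpposite.unop_injective
  rw [← hx]
  exact congrArg MulOpposite.unop hz

/-- The Jucys-Murphy elements `L_1 = T_0`, `L_{k+1} = q⁻¹ T_k L_k T_k`, indexed from `0`: the
element `jm k` is `L_{k+1}`. -/
noncomputable def jm {n : ℕ} : (k : ℕ) → k < n → ArikiKoike q Q n
  | 0, h => T q Q ⟨0, h⟩
  | k + 1, h => ((q⁻¹ : Kˣ) : K) •
      (T q Q ⟨k + 1, h⟩ * jm k (Nat.lt_of_succ_lt h) * T q Q ⟨k + 1, h⟩)

end ArikiKoike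

/-- The simple transposition `s_i` exchanging the `i`-th and `(i+1)`-st point (counted from `1`),
that is, `i - 1` and `i` in `Fin n`; used for `i ≥ 1` only. -/
def simpleTransposition {n : ℕ} (i : Fin n) : Equiv.Perm (Fin n) :=
  Equiv.swap ⟨i.val - 1, (Nat.sub_le _ _).trans_lt i.isLt⟩ i

/-- `l` is a word in the simple transpositions `s_1, …, s_{n-1}` with product `w`. -/
def IsWord {n : ℕ} (w : Equiv.Perm (Fin n)) (l : List (Fin n)) : Prop :=
  (∀ i ∈ l, 0 < i.val) ∧ (l.map simpleTransposition).prod = w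

theorem exists_isWord {n : ℕ} (w : Equiv.Perm (Fin n)) : ∃ l, IsWord w l := by
  cases n with
  | zero => exact ⟨[], by simp, Subsingleton.elim _ _⟩
  | succ n =>
    have hw : w ∈ Submonoid.closure
        (Set.range fun i : Fin n => Equiv.swap i.castSucc i.succ) := by
      rw [Equiv.Perm.mclosure_swap_castSucc_succ]; trivial
    induction hw using Submonoid.closure_induction with
    | mem x hx =>
      obtain ⟨i, rfl⟩ := hx
      refine ⟨[i.succ], by simp, ?_⟩
      simp only [List.map_cons, List.map_nil, List.prod_cons, List.prod_nil, mul_one]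
      rfl
    | one => exact ⟨[], by simp, by simp⟩
    | mul x y _ _ hx hy =>
      obtain ⟨l, hl, rfl⟩ := hx
      obtain ⟨l', hl', rfl⟩ := hy
      refine ⟨l ++ l', ?_, by simp⟩
      intro i hi
      rcases List.mem_append.1 hi with h | h
      · exact hl i h
      · exact hl' i h

theorem exists_reducedWord {n : ℕ} (w : Equiv.Perm (Fin n)) :
    ∃ l, IsWord w l ∧ ∀ l', IsWord w l' → l.length ≤ l'.length := by
  classical
  have h : ∃ k l, IsWord w l ∧ l.length = k := by
    obtain ⟨l, hl⟩ := exists_isWord w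
    exact ⟨_, l, hl, rfl⟩
  obtain ⟨l, hl, hk⟩ := Nat.find_spec h
  exact ⟨l, hl, fun l' hl' => hk ▸ Nat.find_min' h ⟨l', hl', rfl⟩⟩

/-- A reduced word of `w`. -/
noncomputable def reducedWord {n : ℕ} (w : Equiv.Perm (Fin n)) : List (Fin n) :=
  (exists_reducedWord w).choose

namespace ArikiKoike

variable {K : Type*} [Field K] {r : ℕ} (q : Kˣ) (Q : Fin r → Kˣ)

/-- `T_w = T_{i_1} ⋯ T_{i_k}` for a reduced word `w = s_{i_1} ⋯ s_{i_k}`. -/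
noncomputable def Tw {n : ℕ} (w : Equiv.Perm (Fin n)) : ArikiKoike q Q n :=
  ((reducedWord w).map (T q Q)).prod

/-- `x_λ`, the sum of `T_w` over the row stabilizer of the initial tableau. -/
noncomputable def xElt {n : ℕ} (lam : Multipartition r n) : ArikiKoike q Q n :=
  ∑ w ∈ multiRowStab lam, Tw q Q w

/-- `u_λ⁺`, the product of `L_k - Q_s` over all `s` and all `1 ≤ k ≤ |λ⁽¹⁾| + ⋯ + |λ⁽ˢ⁻¹⁾|`. -/
noncomputable def uElt {n : ℕ} (lam : Multipartition r n) : ArikiKoike q Q n :=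
  ((List.finRange r).map fun s =>
    (((List.finRange n).filter fun k => k.val < boxesBefore lam.1 s).map fun k =>
      jm q Q k.val k.isLt - algebraMap K (ArikiKoike q Q n) (Q s : K)).prod).prod

/-- `m_λ = u_λ⁺ x_λ`. -/
noncomputable def mElt {n : ℕ} (lam : Multipartition r n) : ArikiKoike q Q n :=
  uElt q Q lam * xElt q Q lam

/-- The elements `m_μ` for the multipartitions `μ` strictly dominating `lam`.  The two-sided ideal
they generate is the `K`-span of the Murphy basis elements `m_{𝔲𝔳}` with `𝔲`, `𝔳` standard of
a shape strictly dominating `lam`. -/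
def above {n : ℕ} (lam : Multipartition r n) : Set (ArikiKoike q Q n) :=
  {z | ∃ mu : Multipartition r n, MultiDominates mu.1 lam.1 ∧ mu ≠ lam ∧ z = mElt q Q mu}

/-- The Specht module `S^λ`, a right `H_n`-module. -/
noncomputable abbrev Specht {n : ℕ} (lam : Multipartition r n) :
    Submodule (ArikiKoike q Q n)ᵐᵒᵖ (ArikiKoike q Q n ⧸ cellIdeal (above q Q lam)) :=
  cellModule (mElt q Q lam) (above q Q lam)

/-- `D^λ = S^λ / rad S^λ`, a right `H_n`-module. -/
abbrev D {n : ℕ} (lam : Multipartition r n) : Type _ :=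
  cellHead (star q Q n) (star_surjective q Q n) (mElt q Q lam) (above q Q lam)

/-- Parabolic induction `M ↦ M ⊗_{H_n} H_{n+1}` of right modules. -/
abbrev Ind (n : ℕ) (M : Type*) [AddCommGroup M] [Module (ArikiKoike q Q n)ᵐᵒᵖ M] : Type _ :=
  RightInduced (incl q Q n).toRingHom M

end ArikiKoike

/-! ### Group algebras of symmetric groups -/

namespace SymGroupAlg

variable (K : Type*) [Field K]

/-- The anti-automorphism `w ↦ w⁻¹` of the group algebra. -/
noncomputable def star (n : ℕ) : MonoidAlgebra K (Equiv.Perm (Fin n)) →ₐ[K]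
    (MonoidAlgebra K (Equiv.Perm (Fin n)))ᵐᵒᵖ :=
  MonoidAlgebra.lift K _ (Equiv.Perm (Fin n))
    { toFun := fun w => MulOpposite.op (MonoidAlgebra.of K (Equiv.Perm (Fin n)) w⁻¹)
      map_one' := by simp [MonoidAlgebra.one_def]
      map_mul' := by
        intro v w
        rw [mul_inv_rev, map_mul, MulOpposite.op_mul] }

theorem star_surjective (n : ℕ) : Function.Surjective (star K n) := by
  have key : ∀ x : MonoidAlgebra K (Equiv.Perm (Fin n)),
      MulOpposite.op x ∈ (star K n).range := by
    intro x
    induction x using MonoidAlgebra.induction_on with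
    | of w =>
      refine ⟨MonoidAlgebra.of K _ w⁻¹, ?_⟩
      simp [star]
    | add a b ha hb =>
      rw [MulOpposite.op_add]
      exact add_mem ha hb
    | smul c a ha =>
      rw [MulOpposite.op_smul]
      exact Subalgebra.smul_mem _ ha c
  intro y
  exact key y.unop

/-- `x_α`, the sum of the row stabilizer of the initial tableau. -/
noncomputable def xElt {n : ℕ} (α : YPartition n) : MonoidAlgebra K (Equiv.Perm (Fin n)) :=
  ∑ w ∈ rowStab α, MonoidAlgebra.of K (Equiv.Perm (Fin n)) w

/-- The elements `x_β` for the partitions `β` strictly dominating `α`. -/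
def above {n : ℕ} (α : YPartition n) : Set (MonoidAlgebra K (Equiv.Perm (Fin n))) :=
  {z | ∃ β : YPartition n, Dominates β.1 α.1 ∧ β ≠ α ∧ z = xElt K β}

/-- The Specht module `S^α`, a right `K[S_n]`-module (in the normalization in which `D^α ≠ 0` if and
only if `α` is `p`-restricted, `p` being the characteristic of `K`). -/
noncomputable abbrev Specht {n : ℕ} (α : YPartition n) :
    Submodule (MonoidAlgebra K (Equiv.Perm (Fin n)))ᵐᵒᵖ
      (MonoidAlgebra K (Equiv.Perm (Fin n)) ⧸ cellIdeal (above K α)) :=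
  cellModule (xElt K α) (above K α)

/-- `D^α = S^α / rad S^α`, a right `K[S_n]`-module. -/
abbrev D {n : ℕ} (α : YPartition n) : Type _ :=
  cellHead (star K n) (star_surjective K n) (xElt K α) (above K α)

/-- The embedding `K[S_n] → K[S_{n+1}]` for which `S_n` is the stabilizer of the last point. -/
noncomputable def incl (n : ℕ) :
    MonoidAlgebra K (Equiv.Perm (Fin n)) →+* MonoidAlgebra K (Equiv.Perm (Fin (n + 1))) :=
  MonoidAlgebra.mapDomainRingHom K
    (Equiv.Perm.viaEmbeddingHom (Fin.castSuccEmb (n := n)))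

/-- Induction of right modules from `K[S_n]` to `K[S_{n+1}]`. -/
abbrev Ind (n : ℕ) (M : Type*) [AddCommGroup M]
    [Module (MonoidAlgebra K (Equiv.Perm (Fin n)))ᵐᵒᵖ M] : Type _ :=
  RightInduced (incl K n) M

end SymGroupAlg

/-! For `q = 1` the generators `T_1, …, T_{n-1}` are Coxeter involutions, so `w ↦ T_w` is
multiplicative (`Tw_mul`) and conjugation by `T_w` permutes the Jucys-Murphy elements (`Tw_mul_jm`).
Connectedness makes all parameters equal to one scalar `c`. The elements `L_k - c` then have
vanishing `r`-th power (`nilJM_pow`) and generate a two-sided ideal with quotient `K[S_n]`; `proj`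
is the quotient map and `sec` a section of it (`proj_sec`, `sub_sec_proj_mem`).

The module `D^λ` is the pullback along `proj` of `E = D^{λ^{(r)}}` (`exists_equiv_D`). The crux is
that `m_λ (L_k - c)` lies in `H^λ` (`mElt_mul_nilJM_mem`): up to left multiples and conjugation it
is `m_μ` for `μ = (∅, …, ∅, (1), β)`, where `β` arises from `λ^{(r)}` by removing a box, and `μ`
strictly dominates `λ`.

Let `M = ind_n(D^λ)`. Since `L_{n+1}` commutes with `H_n`, the rule `d ⊗ a ↦ d ⊗ (L_{n+1} - c) a` is
an endomorphism `Y` of `M` with `Y ^ r = 0` (`indNil_pow`). All `L_k - c` kill the generators of `M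
/ Y M`, so this quotient is an image of the group algebra induction `Ind E` and has length at most
`t` (`length_quotient_range_indNil_le`). In the other direction, `M` maps onto an explicit module
`Ind E ⊗ K[y] / (y ^ r)`, whose `y`-adic filtration forces length at least `r t` (`le_length_ind`);
this explicit quotient takes the place of a basis theorem for `H_n`. Each layer `Y ^ i M / Y ^ (i +
1) M` is a quotient of `M / Y M`, so the two bounds force every layer to be isomorphic to `M / Y M`
and to have length exactly `t` (`layers_of_length_le`). -/

/-! ### Words in the simple transpositions -/

section Words

variable {X : Type*} [Monoid X]

/-- The type `A` Coxeter relations for `t 1, …, t (N - 1)`. -/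
structure SymRelations (t : ℕ → X) (N : ℕ) : Prop where
  sq : ∀ i, 0 < i → i < N → t i * t i = 1
  braid : ∀ i, 0 < i → i + 1 < N → t i * t (i + 1) * t i = t (i + 1) * t i * t (i + 1)
  comm : ∀ i j, 0 < i → i + 1 < j → j < N → t i * t j = t j * t i

theorem SymRelations.mono {t : ℕ → X} {N M : ℕ} (h : SymRelations t N) (hM : M ≤ N) :
    SymRelations t M :=
  ⟨fun i h0 h1 => h.sq i h0 (by omega), fun i h0 h1 => h.braid i h0 (by omega),
    fun i j h0 h1 h2 => h.comm i j h0 h1 (by omega)⟩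

/-- The product `t (j + d - 1) ⋯ t (j + 1) t j` of `d` factors. -/
def descProd (t : ℕ → X) (j : ℕ) : ℕ → X
  | 0 => 1
  | d + 1 => t (j + d) * descProd t j d

theorem descProd_succ_left (t : ℕ → X) (j d : ℕ) :
    descProd t j (d + 1) = descProd t (j + 1) d * t j := by
  induction d with
  | zero => simp [descProd]
  | succ d ih =>
    rw [descProd, ih, ← mul_assoc, descProd]
    congr 3
    omega

theorem descProd_comm_lt {t : ℕ → X} {N : ℕ} (h : SymRelations t N) {i j d : ℕ} (hi : 0 < i)
    (hij : i + 1 < j) (hd : j + d ≤ N) : descProd t j d * t i = t i * descProd t j d := by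
  induction d with
  | zero => simp [descProd]
  | succ d ih =>
    rw [descProd, mul_assoc, ih (by omega), ← mul_assoc, ← mul_assoc,
      h.comm i (j + d) hi (by omega) (by omega)]

/-- Coming from the right, `t (i + 1)` passes the factors of index below `i`, is turned into `t i`
by one braid relation at the factors `t (i + 1) * t i`, and then passes the higher factors. -/
theorem descProd_mul_gt {t : ℕ → X} {N : ℕ} (h : SymRelations t N) {i j d : ℕ} (hj : 0 < j)
    (hij : j ≤ i) (hi : i + 1 < j + d) (hd : j + d ≤ N) :
    descProd t j d * t (i + 1) = t i * descProd t j d := by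
  induction d with
  | zero => omega
  | succ d ih =>
    rcases Nat.lt_or_ge (i + 1) (j + d) with h1 | h1
    · rw [descProd, mul_assoc, ih h1 (by omega), ← mul_assoc, ← mul_assoc,
        h.comm i (j + d) (by omega) (by omega) (by omega)]
    · obtain ⟨e, rfl⟩ : ∃ e, d = e + 1 := ⟨d - 1, by omega⟩
      obtain rfl : i = j + e := by omega
      have hc : descProd t j e * t (j + e + 1) = t (j + e + 1) * descProd t j e := by
        clear ih hij h1 hi
        suffices ∀ e', e' ≤ e → descProd t j e' * t (j + e + 1) =
            t (j + e + 1) * descProd t j e' from this e le_rfl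
        intro e' he'
        induction e' with
        | zero => simp [descProd]
        | succ e' ih =>
          rw [descProd, mul_assoc, ih (by omega), ← mul_assoc, ← mul_assoc,
            h.comm (j + e') (j + e + 1) (by omega) (by omega) (by omega)]
      have hb := h.braid (j + e) (by omega) (by omega)
      simp only [descProd]
      rw [show j + (e + 1) = j + e + 1 by omega, mul_assoc, mul_assoc, hc, ← mul_assoc,
        ← mul_assoc, ← hb]
      simp only [mul_assoc]

/-- The submonoid generated by `t 1, …, t (N - 1)`. -/
def wordSubmonoid (t : ℕ → X) (N : ℕ) : Submonoid X :=
  Submonoid.closure {x | ∃ i, 0 < i ∧ i < N ∧ x = t i}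

/-- The factors `descProd t j d = t N ⋯ t j` play the role of coset representatives. Multiplying by
`t i` on the right leaves the representative unchanged for `i + 1 < j`, lengthens it for `i + 1 =
j`, shortens it for `i = j`, and for `i > j` passes through it as `t (i - 1)`. -/
theorem wordSubmonoid_normalForm {t : ℕ → X} {N : ℕ} (h : SymRelations t (N + 1)) {z : X}
    (hz : z ∈ wordSubmonoid t (N + 1)) :
    ∃ z' ∈ wordSubmonoid t N, ∃ j d, 0 < j ∧ j + d = N + 1 ∧ z = z' * descProd t j d := by
  induction hz using Submonoid.closure_induction_right with
  | one => exact ⟨1, one_mem _, N + 1, 0, by omega, rfl, by simp [descProd]⟩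
  | mul_right x _ y hy ih =>
    obtain ⟨i, hi0, hi, rfl⟩ := hy
    obtain ⟨z', hz', j, d, hj, hd, rfl⟩ := ih
    have mem : ∀ k, 0 < k → k < N → t k ∈ wordSubmonoid t N := fun k h0 h1 =>
      Submonoid.subset_closure ⟨k, h0, h1, rfl⟩
    rcases Nat.lt_trichotomy (i + 1) j with h1 | h1 | h1
    · refine ⟨z' * t i, mul_mem hz' (mem i hi0 (by omega)), j, d, hj, hd, ?_⟩
      rw [mul_assoc, descProd_comm_lt h hi0 h1 hd.le, mul_assoc]
    · subst h1
      exact ⟨z', hz', i, d + 1, hi0, by omega, by rw [descProd_succ_left, mul_assoc]⟩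
    · rcases (show j ≤ i by omega).eq_or_lt with h2 | h2
      · subst h2
        obtain ⟨e, rfl⟩ : ∃ e, d = e + 1 := ⟨d - 1, by omega⟩
        refine ⟨z', hz', j + 1, e, by omega, by omega, ?_⟩
        rw [descProd_succ_left, mul_assoc, mul_assoc, h.sq j hj (by omega), mul_one]
      · obtain ⟨k, rfl⟩ : ∃ k, i = k + 1 := ⟨i - 1, by omega⟩
        refine ⟨z' * t k, mul_mem hz' (mem k (by omega) (by omega)), j, d, hj, hd, ?_⟩
        rw [mul_assoc, descProd_mul_gt h hj (by omega) (by omega) hd.le, mul_assoc]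

/-- The simple transposition of `i - 1` and `i` in `Fin n`, or `1` if `i` is not in `Fin n`. -/
def simpleTranspositionNat (n i : ℕ) : Equiv.Perm (Fin n) :=
  if h : i < n then simpleTransposition ⟨i, h⟩ else 1

theorem simpleTranspositionNat_apply {n i : ℕ} (hi : i < n) (x : Fin n) :
    (simpleTranspositionNat n i x : ℕ) =
      if x.val = i - 1 then i else if x.val = i then i - 1 else x.val := by
  simp only [simpleTranspositionNat, hi, dif_pos, simpleTransposition, Equiv.swap_apply_def,
    Fin.ext_iff]
  split_ifs <;> rfl

theorem symRelations_simpleTranspositionNat (n : ℕ) :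
    SymRelations (simpleTranspositionNat n) n := by
  constructor
  · intro i h0 h1
    simp [simpleTranspositionNat, h1, simpleTransposition]
  · intro i h0 h1
    ext x
    simp only [Equiv.Perm.mul_apply, simpleTranspositionNat_apply (show i < n by omega),
      simpleTranspositionNat_apply h1]
    grind
  · intro i j h0 h1 h2
    ext x
    simp only [Equiv.Perm.mul_apply, simpleTranspositionNat_apply (show i < n by omega),
      simpleTranspositionNat_apply h2]
    grind

/-- Serves to evaluate a word simultaneously in `X` and in the symmetric group, so that the normal
form applies to both values at once. -/
theorem SymRelations.prod {Y : Type*} [Monoid Y] {t : ℕ → X} {s : ℕ → Y} {N : ℕ}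
    (h : SymRelations t N) (h' : SymRelations s N) : SymRelations (fun i => (t i, s i)) N :=
  ⟨fun i h0 h1 => Prod.ext (h.sq i h0 h1) (h'.sq i h0 h1),
    fun i h0 h1 => Prod.ext (h.braid i h0 h1) (h'.braid i h0 h1),
    fun i j h0 h1 h2 => Prod.ext (h.comm i j h0 h1 h2) (h'.comm i j h0 h1 h2)⟩

theorem wordSubmonoid_apply_of_le {n : ℕ} {t : ℕ → X} {N : ℕ}
    {z : X × Equiv.Perm (Fin n)}
    (hz : z ∈ wordSubmonoid (fun i => (t i, simpleTranspositionNat n i)) N) (x : Fin n)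
    (hx : N ≤ x.val) : z.2 x = x := by
  induction hz using Submonoid.closure_induction with
  | one => rfl
  | mul a b _ _ ha hb => simp [ha, hb]
  | mem a ha =>
    obtain ⟨i, h0, h1, rfl⟩ := ha
    ext
    rw [simpleTranspositionNat_apply (by omega)]
    grind

theorem descProd_apply {n : ℕ} {t : ℕ → X} {j d : ℕ} (hd : j + d ≤ n) (x : Fin n)
    (hx : x.val + 1 = j) :
    ((descProd (fun i => (t i, simpleTranspositionNat n i)) j d).2 x).val + 1 = j + d := by
  induction d with
  | zero => simpa [descProd] using hx
  | succ d ih =>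
    have := ih (by omega)
    simp only [descProd, Prod.snd_mul, Equiv.Perm.mul_apply]
    rw [simpleTranspositionNat_apply (by omega), if_pos (by omega)]
    omega

/-- The permutation of a normal form sends `j - 1` to the last moved point, because the left factor
fixes that point. Hence the permutation determines `j`; the coset representative cancels and
induction applies to the left factor. No word needs to be reduced, since the generators are
involutions. -/
theorem wordSubmonoid_ext {n : ℕ} {t : ℕ → X} {N : ℕ} (hN : N ≤ n) (h : SymRelations t N)
    {z w : X × Equiv.Perm (Fin n)}
    (hz : z ∈ wordSubmonoid (fun i => (t i, simpleTranspositionNat n i)) N)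
    (hw : w ∈ wordSubmonoid (fun i => (t i, simpleTranspositionNat n i)) N)
    (hzw : z.2 = w.2) : z = w := by
  induction N generalizing z w with
  | zero =>
    have : wordSubmonoid (fun i => (t i, simpleTranspositionNat n i)) 0 = ⊥ := by
      simp [wordSubmonoid]
    rw [this, Submonoid.mem_bot] at hz hw
    rw [hz, hw]
  | succ N ih =>
    have hp := h.prod ((symRelations_simpleTranspositionNat n).mono hN)
    obtain ⟨z', hz', j, d, hj, hd, rfl⟩ := wordSubmonoid_normalForm hp hz
    obtain ⟨w', hw', k, e, hk, he, rfl⟩ := wordSubmonoid_normalForm hp hw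
    have key : ∀ {z' : X × Equiv.Perm (Fin n)} {j d : ℕ},
        z' ∈ wordSubmonoid (fun i => (t i, simpleTranspositionNat n i)) N → ∀ hj : 0 < j,
        ∀ hd : j + d = N + 1,
        (z' * descProd (fun i => (t i, simpleTranspositionNat n i)) j d).2 ⟨j - 1, by omega⟩ =
          ⟨N, hN⟩ := by
      intro z' j d hz' hj hd
      rw [Prod.snd_mul, Equiv.Perm.mul_apply]
      have := descProd_apply (t := t) (by omega : j + d ≤ n) ⟨j - 1, by omega⟩
        (by simp only; omega)
      rw [show (descProd (fun i => (t i, simpleTranspositionNat n i)) j d).2 ⟨j - 1, by omega⟩ =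
        ⟨N, hN⟩ from Fin.ext (by simp only; omega)]
      exact wordSubmonoid_apply_of_le hz' _ le_rfl
    have h1 := key hz' hj hd
    rw [hzw, ← key hw' hk he, EmbeddingLike.apply_eq_iff_eq, Fin.mk.injEq] at h1
    obtain rfl : j = k := by omega
    obtain rfl : d = e := by omega
    rw [Prod.snd_mul, Prod.snd_mul, mul_left_inj] at hzw
    rw [ih (by omega) (h.mono (by omega)) hz' hw' hzw]

/-- The product of a word in elements satisfying the Coxeter relations only depends on the
permutation represented by the word. -/
theorem SymRelations.prod_eq_of_isWord {n : ℕ} {t : ℕ → X} (h : SymRelations t n)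
    {w : Equiv.Perm (Fin n)} {l l' : List (Fin n)} (hl : IsWord w l) (hl' : IsWord w l') :
    (l.map fun i => t i.val).prod = (l'.map fun i => t i.val).prod := by
  have key : ∀ {l : List (Fin n)}, IsWord w l →
      ((l.map fun i => t i.val).prod, w) ∈
        wordSubmonoid (fun i => (t i, simpleTranspositionNat n i)) n := by
    intro l hl
    have : ((l.map fun i => t i.val).prod, w) =
        (l.map fun i => (t i.val, simpleTranspositionNat n i.val)).prod := by
      rw [← hl.2]
      clear hl
      induction l with
      | nil => rfl
      | cons i l ih =>
        simp only [List.map_cons, List.prod_cons, ← ih, Prod.mk_mul_mk]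
        simp [simpleTranspositionNat]
    rw [this]
    refine list_prod_mem fun x hx => ?_
    obtain ⟨i, hi, rfl⟩ := List.mem_map.1 hx
    exact Submonoid.subset_closure ⟨i, hl.1 i hi, i.isLt, rfl⟩
  exact congrArg Prod.fst (wordSubmonoid_ext le_rfl h (key hl) (key hl') rfl)

end Words

theorem isWord_reducedWord {n : ℕ} (w : Equiv.Perm (Fin n)) : IsWord w (reducedWord w) :=
  (exists_reducedWord w).choose_spec.1

/-! ### Ariki-Koike algebras with `q = 1` -/

namespace ArikiKoike

section General

variable {K : Type*} [Field K] {r : ℕ} {q : Kˣ} {Q : Fin r → Kˣ}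

theorem induction_on {n : ℕ} {P : ArikiKoike q Q n → Prop} (a : ArikiKoike q Q n)
    (scalar : ∀ c : K, P (algebraMap K _ c)) (gen : ∀ i, P (T q Q i))
    (add : ∀ a b, P a → P b → P (a + b)) (mul : ∀ a b, P a → P b → P (a * b)) : P a := by
  obtain ⟨x, rfl⟩ : ∃ x, mk q Q n x = a := RingQuot.mkAlgHom_surjective K (Relation q Q n) a
  induction x using FreeAlgebra.induction with
  | grade0 c => simpa using scalar c
  | grade1 i => exact gen i
  | mul a b ha hb => simpa using mul _ _ ha hb
  | add a b ha hb => simpa using add _ _ ha hb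

theorem incl_T {n : ℕ} (i : Fin n) : incl q Q n (T q Q i) = T q Q i.castSucc :=
  lift_T ..

end General

variable {K : Type*} [Field K] {r : ℕ} {Q : Fin r → Kˣ} {n : ℕ}

theorem T_mul_self (i : Fin n) (h : 0 < i.val) : T 1 Q i * T 1 Q i = 1 := by
  have := mk_eq 1 Q (Relation.quadratic (q := 1) (Q := Q) i h)
  simp only [map_mul, map_sub, map_add, mk_ι, map_one, map_zero, Units.val_one] at this
  rw [← sub_eq_zero, ← this]
  noncomm_ring

theorem T_braid (i j : Fin n) (hi : 0 < i.val) (hj : j.val = i.val + 1) :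
    T 1 Q i * T 1 Q j * T 1 Q i = T 1 Q j * T 1 Q i * T 1 Q j := by
  simpa [mk_ι] using mk_eq 1 Q (Relation.braidThree (q := 1) (Q := Q) i j hi hj)

theorem T_comm (i j : Fin n) (h : i.val + 1 < j.val) :
    T 1 Q i * T 1 Q j = T 1 Q j * T 1 Q i := by
  simpa [mk_ι] using mk_eq 1 Q (Relation.comm (q := 1) (Q := Q) i j h)

variable (Q) in
/-- The generators indexed by all natural numbers. -/
def TNat (n i : ℕ) : ArikiKoike 1 Q n := if h : i < n then T 1 Q ⟨i, h⟩ else 1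

theorem symRelations_TNat : SymRelations (TNat Q n) n := by
  constructor
  · intro i h0 h1
    simpa [TNat, h1] using T_mul_self (Q := Q) ⟨i, h1⟩ h0
  · intro i h0 h1
    simpa [TNat, h1, show i < n by omega] using
      T_braid (Q := Q) ⟨i, by omega⟩ ⟨i + 1, h1⟩ h0 rfl
  · intro i j h0 h1 h2
    simpa [TNat, h2, show i < n by omega] using T_comm (Q := Q) ⟨i, by omega⟩ ⟨j, h2⟩ h1

/-- Frees `T_w` from the chosen reduced word: concatenated words, reduced or not, may be used, which
gives multiplicativity. -/
theorem Tw_eq_of_isWord {w : Equiv.Perm (Fin n)} {l : List (Fin n)} (hl : IsWord w l) :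
    Tw 1 Q w = (l.map (T 1 Q)).prod := by
  have := symRelations_TNat (Q := Q).prod_eq_of_isWord (isWord_reducedWord w) hl
  simpa [TNat, Tw] using this

theorem Tw_one : Tw 1 Q (1 : Equiv.Perm (Fin n)) = 1 := by
  simpa using Tw_eq_of_isWord (Q := Q) (l := []) (w := (1 : Equiv.Perm (Fin n))) ⟨by simp, rfl⟩

theorem Tw_mul (v w : Equiv.Perm (Fin n)) : Tw 1 Q (v * w) = Tw 1 Q v * Tw 1 Q w := by
  have hv := isWord_reducedWord v
  have hw := isWord_reducedWord w
  rw [Tw_eq_of_isWord (l := reducedWord v ++ reducedWord w), List.map_append, List.prod_append]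
  · rfl
  · refine ⟨fun i hi => ?_, by rw [List.map_append, List.prod_append, hv.2, hw.2]⟩
    exact (List.mem_append.1 hi).elim (hv.1 i) (hw.1 i)

theorem Tw_simpleTransposition (i : Fin n) (h : 0 < i.val) :
    Tw 1 Q (simpleTransposition i) = T 1 Q i := by
  simpa using Tw_eq_of_isWord (Q := Q) (l := [i]) ⟨by simpa, by simp⟩

variable (Q n) in
/-- For `q = 1` the map `w ↦ T_w` is multiplicative. -/
noncomputable def TwHom : Equiv.Perm (Fin n) →* ArikiKoike 1 Q n where
  toFun := Tw 1 Q
  map_one' := Tw_one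
  map_mul' := Tw_mul

variable (Q n) in
/-- The homomorphism `K[S_n] → H_n`, `w ↦ T_w`, for `q = 1`. -/
noncomputable def sec : MonoidAlgebra K (Equiv.Perm (Fin n)) →ₐ[K] ArikiKoike 1 Q n :=
  MonoidAlgebra.lift K _ _ (TwHom Q n)

theorem sec_of (w : Equiv.Perm (Fin n)) :
    sec Q n (MonoidAlgebra.of K _ w) = Tw 1 Q w := by
  simp [sec, TwHom]

theorem perm_induction {P : Equiv.Perm (Fin n) → Prop} (w : Equiv.Perm (Fin n)) (one : P 1)
    (mul : ∀ (i : Fin n) (w), 0 < i.val → P w → P (simpleTransposition i * w)) : P w := by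
  obtain ⟨l, hl, rfl⟩ := exists_isWord w
  induction l with
  | nil => exact one
  | cons i l ih =>
    simp only [List.map_cons, List.prod_cons]
    exact mul i _ (hl i (by simp)) (ih fun j hj => hl j (by simp [hj]))

/-! ### Jucys-Murphy elements -/

theorem jm_succ (k : ℕ) (h : k + 1 < n) :
    jm 1 Q (k + 1) h = T 1 Q ⟨k + 1, h⟩ * jm 1 Q k (Nat.lt_of_succ_lt h) * T 1 Q ⟨k + 1, h⟩ := by
  simp [jm]

/-- Unless `i` is one below the index of the outer factors of `jm k`, `T_i` commutes with those
factors and with the inner element. In the exceptional case the definition is unfolded twice and the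
braid relation applied. -/
theorem T_mul_jm_of_ne (k : ℕ) (hk : k < n) (i : Fin n) (h0 : 0 < i.val) (h1 : i.val ≠ k)
    (h2 : i.val ≠ k + 1) : T 1 Q i * jm 1 Q k hk = jm 1 Q k hk * T 1 Q i := by
  induction k using Nat.strong_induction_on generalizing i with
  | _ k ih =>
    rcases k with _ | k
    · exact (T_comm ⟨0, hk⟩ i (by simp only; omega)).symm
    · rw [jm_succ]
      by_cases h3 : i.val = k
      · obtain ⟨m, rfl⟩ : ∃ m, k = m + 1 := ⟨k - 1, by omega⟩
        obtain rfl : i = ⟨m + 1, Nat.lt_of_succ_lt hk⟩ := Fin.ext h3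
        rw [jm_succ]
        have hb := T_braid (Q := Q) (⟨m + 1, by omega⟩ : Fin n) ⟨m + 1 + 1, hk⟩ (by simp) rfl
        have hL := ih m (by omega) (by omega) ⟨m + 1 + 1, hk⟩ (by simp) (by simp only; omega)
          (by simp)
        generalize T 1 Q (⟨m + 1, _⟩ : Fin n) = a at *
        generalize T 1 Q (⟨m + 1 + 1, _⟩ : Fin n) = b at *
        generalize jm 1 Q m _ = L at *
        -- Two braid moves, separated by `b * L = L * b`, carry the leading `a` to the right end.
        calc a * (b * (a * L * a) * b) = a * b * a * (L * a * b) := by simp only [mul_assoc]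
          _ = b * a * (b * L) * a * b := by rw [hb]; simp only [mul_assoc]
          _ = b * a * L * (b * a * b) := by rw [hL]; simp only [mul_assoc]
          _ = b * (a * L * a) * b * a := by rw [← hb]; simp only [mul_assoc]
      · have hL := ih k (by omega) (by omega) i h0 h3 h1
        have hT : T 1 Q i * T 1 Q ⟨k + 1, hk⟩ = T 1 Q ⟨k + 1, hk⟩ * T 1 Q i := by
          rcases Nat.lt_or_ge i.val (k + 1) with h | h
          · exact T_comm i ⟨k + 1, hk⟩ (by simp only; omega)
          · exact (T_comm ⟨k + 1, hk⟩ i (by simp only; omega)).symm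
        rw [← mul_assoc, ← mul_assoc, hT, mul_assoc (T 1 Q ⟨k + 1, hk⟩), hL]
        simp only [mul_assoc, hT]

theorem simpleTransposition_apply (i x : Fin n) :
    simpleTransposition i x = if x.val = i.val - 1 then i else
      if x = i then ⟨i.val - 1, (Nat.sub_le _ _).trans_lt i.isLt⟩ else x := by
  simp [simpleTransposition, Equiv.swap_apply_def, Fin.ext_iff]

/-- As `T_i` is an involution, `L_{i+1} = T_i L_i T_i` says that conjugation by `T_i` exchanges
`L_i` and `L_{i+1}`; it fixes the others. -/
theorem T_mul_jm (i k : Fin n) (h0 : 0 < i.val) :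
    T 1 Q i * jm 1 Q k.val k.isLt =
      jm 1 Q (simpleTransposition i k).val (simpleTransposition i k).isLt * T 1 Q i := by
  obtain ⟨i, hi⟩ := i
  obtain ⟨m, rfl⟩ : ∃ m, i = m + 1 := ⟨i - 1, by simp only at h0; omega⟩
  have hsq := T_mul_self (Q := Q) (⟨m + 1, hi⟩ : Fin n) h0
  rw [simpleTransposition_apply]
  split_ifs with h1 h2
  · simp only [Nat.add_sub_cancel] at h1
    obtain rfl : k = ⟨m, Nat.lt_of_succ_lt hi⟩ := Fin.ext h1
    simp only
    rw [jm_succ, mul_assoc _ _ (T 1 Q _), hsq, mul_one]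
  · subst h2
    simp only [Nat.add_sub_cancel]
    rw [jm_succ, ← mul_assoc, ← mul_assoc, hsq, one_mul]
  · exact T_mul_jm_of_ne _ _ _ h0 (fun h => h2 (Fin.ext h.symm))
      (fun h => h1 (by simp only at h ⊢; omega))

theorem Tw_mul_jm (w : Equiv.Perm (Fin n)) (k : Fin n) :
    Tw 1 Q w * jm 1 Q k.val k.isLt = jm 1 Q (w k).val (w k).isLt * Tw 1 Q w := by
  induction w using perm_induction with
  | one => simp [Tw_one]
  | mul i w hi ih =>
    rw [Tw_mul, Tw_simpleTransposition i hi, mul_assoc, ih, ← mul_assoc, T_mul_jm i _ hi,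
      mul_assoc, Equiv.Perm.mul_apply]

/-- For `L_2` this is the four-term braid relation; beyond that, the new outer factors commute with
`T_0`. -/
theorem T_zero_mul_jm (h0 : 0 < n) (k : ℕ) (hk : k < n) :
    T 1 Q ⟨0, h0⟩ * jm 1 Q k hk = jm 1 Q k hk * T 1 Q ⟨0, h0⟩ := by
  rcases k with _ | k
  · rfl
  · induction k with
    | zero =>
      have := mk_eq 1 Q (Relation.braidFour (q := 1) (Q := Q) ⟨0, h0⟩ ⟨1, hk⟩ rfl rfl)
      simpa [mk_ι, jm, mul_assoc] using this
    | succ k ih =>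
      have hT := T_comm (Q := Q) ⟨0, h0⟩ ⟨k + 1 + 1, hk⟩ (by simp)
      rw [jm_succ, ← mul_assoc, ← mul_assoc, hT, mul_assoc _ (T 1 Q ⟨0, h0⟩), ih]
      simp only [mul_assoc, hT]

theorem incl_jm (k : ℕ) (hk : k < n) :
    incl 1 Q n (jm 1 Q k hk) = jm 1 Q k (hk.trans (by simp)) := by
  induction k with
  | zero => exact incl_T _
  | succ k ih =>
    rw [jm_succ, jm_succ, map_mul, map_mul, ih, incl_T]
    rfl

/-- This is what makes multiplication by `L_{n+1}` well defined on induced modules. -/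
theorem jm_last_mul_incl (a : ArikiKoike 1 Q n) :
    jm 1 Q n (Nat.lt_succ_self n) * incl 1 Q n a =
      incl 1 Q n a * jm 1 Q n (Nat.lt_succ_self n) := by
  induction a using induction_on with
  | scalar c => simpa using (Algebra.commutes c _).symm
  | gen i =>
    rw [incl_T]
    rcases Nat.eq_zero_or_pos i.val with h | h
    · rw [show i.castSucc = ⟨0, Nat.succ_pos n⟩ from Fin.ext h]
      exact (T_zero_mul_jm _ _ _).symm
    · exact (T_mul_jm_of_ne n _ i.castSucc h i.isLt.ne (by simp; omega)).symm
  | add a b ha hb => rw [map_add, mul_add, ha, hb, add_mul]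
  | mul a b ha hb => rw [map_mul, ← mul_assoc, ha, mul_assoc, hb, mul_assoc]

/-! ### The shifted Jucys-Murphy elements and the projection to the group algebra -/

variable (Q) in
/-- The nilpotent part `L_{k+1} - c` of a Jucys-Murphy element. -/
noncomputable def nilJM (c : K) (k : Fin n) : ArikiKoike 1 Q n :=
  jm 1 Q k.val k.isLt - algebraMap K _ c

variable {c : K}

theorem Tw_mul_nilJM (w : Equiv.Perm (Fin n)) (k : Fin n) :
    Tw 1 Q w * nilJM Q c k = nilJM Q c (w k) * Tw 1 Q w := by
  rw [nilJM, mul_sub, Tw_mul_jm, nilJM, sub_mul, Algebra.commutes]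

theorem Tw_mul_inv (w : Equiv.Perm (Fin n)) : Tw 1 Q w * Tw 1 Q w⁻¹ = 1 := by
  rw [← Tw_mul, mul_inv_cancel, Tw_one]

/-- With equal parameters the cyclotomic relation reads `(T_0 - c) ^ r = 0`, and every `L_k - c` is
conjugate to `T_0 - c` by the `T_w` of a transposition. -/
theorem nilJM_pow (hc : ∀ j, (Q j : K) = c) (k : Fin n) : nilJM Q c k ^ r = 0 := by
  have h0 : 0 < n := k.pos
  have hz : nilJM Q c (⟨0, h0⟩ : Fin n) ^ r = 0 := by
    have := mk_eq 1 Q (Relation.cyclotomic (q := 1) (Q := Q) h0)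
    simp only [hc, List.map_const', List.prod_replicate, List.length_finRange, map_pow, map_sub,
      mk_ι, AlgHom.commutes, map_zero] at this
    exact this
  have key : ∀ m, nilJM Q c k ^ m * Tw 1 Q (Equiv.swap ⟨0, h0⟩ k) =
      Tw 1 Q (Equiv.swap ⟨0, h0⟩ k) * nilJM Q c (⟨0, h0⟩ : Fin n) ^ m := by
    intro m
    induction m with
    | zero => simp
    | succ m ih =>
      have h := Tw_mul_nilJM (Q := Q) (c := c) (Equiv.swap ⟨0, h0⟩ k) ⟨0, h0⟩
      rw [Equiv.swap_apply_left] at h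
      rw [pow_succ, pow_succ, mul_assoc, ← h, ← mul_assoc, ih, mul_assoc]
  rw [← mul_one (nilJM Q c k ^ r), ← Tw_mul_inv (Equiv.swap ⟨0, h0⟩ k), ← mul_assoc, key, hz]
  simp

theorem nilJM_zero (h : 0 < n) :
    T 1 Q ⟨0, h⟩ = nilJM Q c (⟨0, h⟩ : Fin n) + algebraMap K _ c := by
  simp [nilJM, jm]

variable (Q n) in
/-- The two-sided ideal generated by the `L_k - c`, as a right ideal. -/
noncomputable def nilIdeal (c : K) : Submodule (ArikiKoike 1 Q n)ᵐᵒᵖ (ArikiKoike 1 Q n) :=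
  Submodule.span _ (Set.range (nilJM Q c))

theorem nilJM_mul_mem (k : Fin n) (a : ArikiKoike 1 Q n) : nilJM Q c k * a ∈ nilIdeal Q n c :=
  Submodule.smul_mem _ (MulOpposite.op a) (Submodule.subset_span ⟨k, rfl⟩)

theorem mul_mem_nilIdeal_right {x : ArikiKoike 1 Q n} (hx : x ∈ nilIdeal Q n c)
    (a : ArikiKoike 1 Q n) : x * a ∈ nilIdeal Q n c :=
  Submodule.smul_mem _ (MulOpposite.op a) hx

/-- The right ideal is two-sided because `T_i` with `i > 0` permutes its generators up to a right
factor, while `T_0` is the sum of a generator and a scalar. -/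
theorem mul_mem_nilIdeal_left {x : ArikiKoike 1 Q n} (hx : x ∈ nilIdeal Q n c)
    (a : ArikiKoike 1 Q n) : a * x ∈ nilIdeal Q n c := by
  induction a using induction_on generalizing x with
  | scalar d =>
    rw [Algebra.commutes]
    exact mul_mem_nilIdeal_right hx _
  | add a b ha hb => rw [add_mul]; exact add_mem (ha hx) (hb hx)
  | mul a b ha hb => rw [mul_assoc]; exact ha (hb hx)
  | gen i =>
    rcases Nat.eq_zero_or_pos i.val with h | h
    · obtain ⟨i, hi⟩ := i
      obtain rfl : i = 0 := h
      rw [nilJM_zero (c := c), add_mul, Algebra.commutes]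
      exact add_mem (nilJM_mul_mem _ _) (mul_mem_nilIdeal_right hx _)
    · induction hx using Submodule.span_induction with
      | zero => simp
      | add x y _ _ hx hy => rw [mul_add]; exact add_mem hx hy
      | smul b x _ hx =>
        have : T 1 Q i * b • x = (T 1 Q i * x) * b.unop := (mul_assoc _ _ _).symm
        rw [this]
        exact mul_mem_nilIdeal_right hx _
      | mem x hx =>
        obtain ⟨k, rfl⟩ := hx
        rw [← Tw_simpleTransposition i h, Tw_mul_nilJM]
        exact nilJM_mul_mem _ _

/-- With `T_0` sent to a scalar, only the relations of `S_n` remain. The cyclotomic relation becomes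
`0 ^ r = 0`, which is where `r` must be positive. -/
theorem lift_projFun (hr : 0 < r) (hc : ∀ j, (Q j : K) = c) :
    ∀ x y, Relation 1 Q n x y →
      FreeAlgebra.lift K (fun i : Fin n => if i.val = 0 then
        algebraMap K (MonoidAlgebra K (Equiv.Perm (Fin n))) c else
          MonoidAlgebra.of K _ (simpleTransposition i)) x =
      FreeAlgebra.lift K (fun i : Fin n => if i.val = 0 then
        algebraMap K (MonoidAlgebra K (Equiv.Perm (Fin n))) c else
          MonoidAlgebra.of K _ (simpleTransposition i)) y := by
  have hs := symRelations_simpleTranspositionNat n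
  intro x y h
  cases h with
  | cyclotomic h0 =>
    simp [hc, hr.ne']
  | quadratic i h0 =>
    have := hs.sq i h0 i.isLt
    simp only [simpleTranspositionNat, i.isLt, dif_pos, Fin.eta] at this
    simp only [map_mul, map_sub, map_add, FreeAlgebra.lift_ι_apply, if_neg h0.ne',
      Units.val_one, map_one, map_zero]
    rw [sub_mul, mul_add, ← map_mul, this, map_one]
    noncomm_ring
  | braidFour i j hi hj =>
    simp only [map_mul, FreeAlgebra.lift_ι_apply, hi, hj, if_pos, if_neg one_ne_zero]
    rw [Algebra.commutes]
    simp only [mul_assoc]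
    rw [Algebra.commutes]
    simp only [mul_assoc]
  | braidThree i j hi hj =>
    have := hs.braid i hi (by rw [← hj]; exact j.isLt)
    simp only [← hj, simpleTranspositionNat, i.isLt, j.isLt, dif_pos, Fin.eta] at this
    simp only [map_mul, FreeAlgebra.lift_ι_apply, if_neg hi.ne', hj, Nat.succ_ne_zero, if_false]
    rw [← map_mul, ← map_mul, this, map_mul, map_mul]
  | comm i j hij =>
    have hj : j.val ≠ 0 := by omega
    simp only [map_mul, FreeAlgebra.lift_ι_apply, if_neg hj]
    split_ifs with hi
    · rw [Algebra.commutes]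
    · have := hs.comm i j (Nat.pos_of_ne_zero hi) hij j.isLt
      simp only [simpleTranspositionNat, i.isLt, j.isLt, dif_pos, Fin.eta] at this
      rw [← map_mul, this, map_mul]

variable (n) in
/-- The projection `H_n → K[S_n]` with `T_0 ↦ c` and `T_i ↦ s_i`, where all parameters are equal to
`c` and `q = 1`. -/
noncomputable def proj (hr : 0 < r) (hc : ∀ j, (Q j : K) = c) :
    ArikiKoike 1 Q n →ₐ[K] MonoidAlgebra K (Equiv.Perm (Fin n)) :=
  lift 1 Q _ (lift_projFun hr hc)

variable (hr : 0 < r) (hc : ∀ j, (Q j : K) = c)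

theorem proj_T (i : Fin n) : proj n hr hc (T 1 Q i) = if i.val = 0 then
    algebraMap K (MonoidAlgebra K (Equiv.Perm (Fin n))) c else
      MonoidAlgebra.of K _ (simpleTransposition i) :=
  lift_T ..

theorem proj_T_pos (i : Fin n) (h : 0 < i.val) : proj n hr hc (T 1 Q i) =
    MonoidAlgebra.of K _ (simpleTransposition i) := by
  rw [proj_T, if_neg h.ne']

theorem proj_Tw (w : Equiv.Perm (Fin n)) :
    proj n hr hc (Tw 1 Q w) = MonoidAlgebra.of K _ w := by
  induction w using perm_induction with
  | one => rw [Tw_one, map_one, map_one]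
  | mul i w hi ih =>
    rw [Tw_mul, map_mul, ih, Tw_simpleTransposition i hi, proj_T_pos _ _ _ hi, ← map_mul]

theorem proj_sec (b : MonoidAlgebra K (Equiv.Perm (Fin n))) : proj n hr hc (sec Q n b) = b := by
  induction b using MonoidAlgebra.induction_on with
  | of w => rw [sec_of, proj_Tw]
  | add a b ha hb => rw [map_add, map_add, ha, hb]
  | smul d a ha => rw [map_smul, map_smul, ha]

theorem proj_surjective : Function.Surjective (proj (n := n) hr hc) :=
  fun b => ⟨_, proj_sec hr hc b⟩

theorem proj_nilJM (k : Fin n) : proj n hr hc (nilJM Q c k) = 0 := by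
  obtain ⟨k, hk⟩ := k
  rw [nilJM, map_sub, AlgHom.commutes, sub_eq_zero]
  simp only
  induction k with
  | zero => rw [jm, proj_T, if_pos rfl]
  | succ k ih =>
    rw [jm_succ, map_mul, map_mul, ih, ← Algebra.commutes, mul_assoc, ← map_mul,
      T_mul_self _ (by simp), map_one, mul_one]
    exact Nat.lt_of_succ_lt hk

/-- On generators the difference is zero, except for `T_0`, where it is `L_1 - c`; products are
handled by two-sidedness of the ideal. -/
theorem sub_sec_proj_mem (a : ArikiKoike 1 Q n) :
    a - sec Q n (proj n hr hc a) ∈ nilIdeal Q n c := by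
  induction a using induction_on with
  | scalar d =>
    rw [AlgHom.commutes, AlgHom.commutes, sub_self]
    exact zero_mem _
  | gen i =>
    rw [proj_T]
    split_ifs with h
    · obtain ⟨i, hi⟩ := i
      obtain rfl : i = 0 := h
      rw [AlgHom.commutes, nilJM_zero (c := c), add_sub_cancel_right]
      exact Submodule.subset_span ⟨_, rfl⟩
    · rw [sec_of, Tw_simpleTransposition _ (Nat.pos_of_ne_zero h), sub_self]
      exact zero_mem _
  | add a b ha hb =>
    rw [map_add, map_add, add_sub_add_comm]
    exact add_mem ha hb
  | mul a b ha hb =>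
    have : a * b - sec Q n (proj n hr hc (a * b)) =
        (a - sec Q n (proj n hr hc a)) * b +
          sec Q n (proj n hr hc a) * (b - sec Q n (proj n hr hc b)) := by
      rw [map_mul, map_mul, sub_mul, mul_sub]
      abel
    rw [this]
    exact add_mem (mul_mem_nilIdeal_right ha _) (mul_mem_nilIdeal_left hb _)

/-! ### Compatibility of `sec` with the embeddings of index `n` into index `n + 1`. -/

theorem viaEmbedding_castSucc_simpleTransposition (i : Fin n) :
    Equiv.Perm.viaEmbeddingHom Fin.castSuccEmb (simpleTransposition i) =
      simpleTransposition i.castSucc := by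
  ext x
  rw [Equiv.Perm.viaEmbeddingHom_apply]
  induction x using Fin.lastCases with
  | last =>
    rw [Equiv.Perm.viaEmbedding_apply_of_notMem _ _ _ (by simp), simpleTransposition_apply,
      if_neg (by simp; omega), if_neg (Fin.castSucc_lt_last i).ne']
  | cast x =>
    rw [show x.castSucc = Fin.castSuccEmb x from rfl, Equiv.Perm.viaEmbedding_apply,
      simpleTransposition_apply, simpleTransposition_apply]
    simp only [Fin.castSuccEmb_apply, Fin.val_castSucc, Fin.castSucc_inj]
    split_ifs <;> rfl

theorem incl_Tw (w : Equiv.Perm (Fin n)) :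
    incl 1 Q n (Tw 1 Q w) = Tw 1 Q (Equiv.Perm.viaEmbeddingHom Fin.castSuccEmb w) := by
  induction w using perm_induction with
  | one => rw [Tw_one, map_one, map_one, Tw_one]
  | mul i w hi ih =>
    rw [Tw_mul, map_mul, ih, Tw_simpleTransposition i hi, incl_T, map_mul, Tw_mul,
      viaEmbedding_castSucc_simpleTransposition, Tw_simpleTransposition i.castSucc hi]

theorem _root_.SymGroupAlg.incl_of (w : Equiv.Perm (Fin n)) :
    SymGroupAlg.incl K n (MonoidAlgebra.of K _ w) =
      MonoidAlgebra.of K _ (Equiv.Perm.viaEmbeddingHom Fin.castSuccEmb w) := by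
  simp [SymGroupAlg.incl]

theorem _root_.SymGroupAlg.incl_smul (d : K) (b : MonoidAlgebra K (Equiv.Perm (Fin n))) :
    SymGroupAlg.incl K n (d • b) = d • SymGroupAlg.incl K n b := by
  simp [SymGroupAlg.incl, MonoidAlgebra.mapDomain_smul]

theorem incl_sec (b : MonoidAlgebra K (Equiv.Perm (Fin n))) :
    incl 1 Q n (sec Q n b) = sec Q (n + 1) (SymGroupAlg.incl K n b) := by
  induction b using MonoidAlgebra.induction_on with
  | of w => rw [sec_of, incl_Tw, SymGroupAlg.incl_of, sec_of]
  | add a b ha hb => simp only [map_add, ha, hb]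
  | smul d a ha => rw [map_smul, map_smul, ha, SymGroupAlg.incl_smul, map_smul]

end ArikiKoike

/-! ### Maps out of induced modules -/

namespace InducedModule

variable {R S : Type*} [Ring R] [Ring S] {f : R →+* S} {M : Type*} [AddCommGroup M] [Module R M]

variable (f M) in
/-- The canonical map `x ↦ 1 ⊗ x`. -/
def unit : M →+ InducedModule f M :=
  ((balancedRel f M).mkQ.toAddMonoidHom).comp
    (TensorProduct.mk ℤ S M 1).toAddMonoidHom

theorem smul_unit (s : S) (x : M) : s • unit f M x = (balancedRel f M).mkQ (s ⊗ₜ[ℤ] x) := by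
  change s • (balancedRel f M).mkQ ((1 : S) ⊗ₜ[ℤ] x) = _
  rw [← map_smul, TensorProduct.smul_tmul', smul_eq_mul, mul_one]

theorem unit_smul (a : R) (x : M) : unit f M (a • x) = f a • unit f M x := by
  rw [smul_unit, ← one_smul S (unit f M (a • x)), smul_unit, eq_comm, ← sub_eq_zero, ← map_sub]
  refine (Submodule.Quotient.mk_eq_zero _).2 (Submodule.subset_span ⟨1, a, x, ?_⟩)
  rw [one_mul]

theorem induction_on {P : InducedModule f M → Prop} (z : InducedModule f M)
    (smul : ∀ (s : S) (x : M), P (s • unit f M x)) (add : ∀ a b, P a → P b → P (a + b)) : P z := by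
  obtain ⟨z, rfl⟩ := (balancedRel f M).mkQ_surjective z
  induction z using TensorProduct.induction_on with
  | zero => simpa using smul 0 0
  | tmul s x => rw [← smul_unit]; exact smul s x
  | add a b ha hb => rw [map_add]; exact add _ _ ha hb

variable {P : Type*} [AddCommGroup P]

/-- The additive map `s ⊗ x ↦ g s x` for balanced `g`. -/
def liftAdd (g : S →+ M →+ P) (hg : ∀ s a x, g (s * f a) x = g s (a • x)) :
    InducedModule f M →+ P :=
  QuotientAddGroup.lift (balancedRel f M).toAddSubgroup
    (TensorProduct.liftAddHom g fun n s x => by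
      rw [map_zsmul, map_zsmul]; rfl) (by
      intro z hz
      rw [AddMonoidHom.mem_ker]
      -- The map is only additive, so the span is taken as additively generated by the multiples `s
      -- • z` of relations; such a multiple is again a relation.
      induction hz using Submodule.closure_induction with
      | zero => simp
      | add x y _ _ hx hy => rw [map_add, hx, hy, add_zero]
      | smul_mem s z hz =>
        obtain ⟨s', a, x, rfl⟩ := hz
        rw [smul_sub, TensorProduct.smul_tmul', TensorProduct.smul_tmul', map_sub, sub_eq_zero,
          TensorProduct.liftAddHom_tmul, TensorProduct.liftAddHom_tmul, smul_eq_mul, smul_eq_mul,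
          ← mul_assoc, hg])

theorem liftAdd_smul_unit (g : S →+ M →+ P) (hg : ∀ s a x, g (s * f a) x = g s (a • x)) (s : S)
    (x : M) : liftAdd (f := f) g hg (s • unit f M x) = g s x := by
  rw [smul_unit (f := f)]
  rfl

variable [Module S P]

theorem smul_balanced {g : M →+ P} (hg : ∀ a x, g (a • x) = f a • g x) (s : S) (a : R) (x : M) :
    (AddMonoidHom.compHom.flip g).comp AddMonoidHom.smul (s * f a) x =
      (AddMonoidHom.compHom.flip g).comp AddMonoidHom.smul s (a • x) := by
  change (s * f a) • g x = s • g (a • x)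
  rw [hg, mul_smul]

/-- The universal property of induction. -/
def lift (g : M →+ P) (hg : ∀ a x, g (a • x) = f a • g x) : InducedModule f M →ₗ[S] P where
  toFun := liftAdd ((AddMonoidHom.compHom.flip g).comp AddMonoidHom.smul) (smul_balanced hg)
  map_add' := map_add _
  map_smul' s z := by
    induction z using induction_on with
    | smul s' x =>
      rw [smul_smul, liftAdd_smul_unit, liftAdd_smul_unit]
      exact mul_smul s s' (g x)
    | add a b ha hb => rw [smul_add, map_add, ha, hb, map_add, smul_add]

theorem lift_unit (g : M →+ P) (hg : ∀ a x, g (a • x) = f a • g x) (x : M) :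
    lift g hg (unit f M x) = g x := by
  rw [← one_smul S (unit f M x)]
  exact (liftAdd_smul_unit _ (smul_balanced hg) 1 x).trans (one_smul S (g x))

theorem lift_surjective (g : M →+ P) (hg : ∀ a x, g (a • x) = f a • g x)
    (h : ∀ N : Submodule S P, (∀ x, g x ∈ N) → N = ⊤) : Function.Surjective (lift (f := f) g hg) :=
  LinearMap.range_eq_top.1 (h _ fun x => ⟨_, lift_unit g hg x⟩)

/-- A right `R`-linear retraction `ρ` yields the left inverse `s ⊗ x ↦ ρ(s) x`. -/
theorem unit_injective (ρ : S →+ R) (h1 : ρ 1 = 1) (hρ : ∀ s a, ρ (s * f a) = ρ s * a) :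
    Function.Injective (unit f M) := by
  have : Function.LeftInverse (liftAdd (f := f) (P := M)
      (AddMonoidHom.smul.comp ρ) fun s a x => by
        change ρ (s * f a) • x = ρ s • a • x
        rw [hρ, mul_smul]) (unit f M) := by
    intro x
    rw [← one_smul S (unit f M x), liftAdd_smul_unit]
    change ρ 1 • x = x
    rw [h1, one_smul]
  exact this.injective

end InducedModule

/-! ### Modules with a nilpotent endomorphism -/

section Layers

variable {R M : Type*} [Ring R] [AddCommGroup M] [Module R M]

theorem Module.length_quotient_submoduleOf_add {p p' : Submodule R M} (h : p ≤ p') :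
    Module.length R p + Module.length R (p' ⧸ p.submoduleOf p') = Module.length R p' := by
  rw [Module.length_eq_add_of_exact (p.submoduleOf p').subtype (p.submoduleOf p').mkQ
    (Submodule.subtype_injective _) (Submodule.mkQ_surjective _)
    (LinearMap.exact_subtype_mkQ _), (Submodule.submoduleOfEquivOfLe h).length_eq]

theorem Module.le_length_of_chain {N : ℕ → Submodule R M} {r : ℕ} {t : ℕ∞}
    (hN : ∀ i, i < r → N (i + 1) ≤ N i)
    (ht : ∀ i, i < r → t ≤ Module.length R (N i ⧸ (N (i + 1)).submoduleOf (N i))) :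
    r * t ≤ Module.length R (N 0) := by
  induction r generalizing N with
  | zero => simp
  | succ r ih =>
    have := ih (N := fun i => N (i + 1)) (fun i hi => hN _ (by omega)) fun i hi => ht _ (by omega)
    rw [← Module.length_quotient_submoduleOf_add (hN 0 (by omega))]
    push_cast
    rw [add_mul, one_mul]
    exact add_le_add this (ht 0 (by omega))

variable (Y : M →ₗ[R] M)

theorem range_pow_succ_le (i : ℕ) : LinearMap.range (Y ^ (i + 1)) ≤ LinearMap.range (Y ^ i) := by
  rw [pow_succ, Module.End.mul_eq_comp]
  exact LinearMap.range_comp_le_range _ _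

/-- The map induced by `Y ^ i` from `M / Y M` onto `Y ^ i M / Y ^ (i + 1) M`. -/
def toLayer (i : ℕ) : (M ⧸ LinearMap.range Y) →ₗ[R] (LinearMap.range (Y ^ i) ⧸
    (LinearMap.range (Y ^ (i + 1))).submoduleOf (LinearMap.range (Y ^ i))) :=
  (LinearMap.range Y).liftQ ((Submodule.mkQ _).comp (Y ^ i).rangeRestrict) (by
    rintro _ ⟨x, rfl⟩
    rw [LinearMap.mem_ker, LinearMap.comp_apply, Submodule.mkQ_apply,
      Submodule.Quotient.mk_eq_zero]
    exact ⟨x, by rw [pow_succ]; rfl⟩)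

theorem toLayer_surjective (i : ℕ) : Function.Surjective (toLayer Y i) := by
  rw [← LinearMap.range_eq_top, toLayer, Submodule.range_liftQ, LinearMap.range_eq_top]
  exact (Submodule.mkQ_surjective _).comp (LinearMap.surjective_rangeRestrict _)

theorem LinearMap.injective_of_surjective_of_length_le {N : Type*} [AddCommGroup N] [Module R N]
    {f : M →ₗ[R] N} (hf : Function.Surjective f) (h : Module.length R M ≤ Module.length R N)
    (hN : Module.length R N ≠ ⊤) : Function.Injective f := by
  rw [Module.length_eq_add_of_exact (LinearMap.ker f).subtype f
    (Submodule.subtype_injective _) hf (LinearMap.exact_subtype_ker_map f)] at h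
  rw [← LinearMap.ker_eq_bot, ← Submodule.subsingleton_iff_eq_bot,
    ← Module.length_eq_zero_iff (R := R)]
  generalize Module.length R (LinearMap.ker f) = a at *
  lift Module.length R N to ℕ using hN with b
  have ha : a ≠ ⊤ := by
    rintro rfl
    simp at h
  lift a to ℕ using ha
  norm_cast at h ⊢
  omega

variable {Y}

/-- If `Y` is a nilpotent endomorphism of `M` with `Y ^ r = 0` and the length of `M` is at least
`r` times that of `M / Y M`, then the layers `Y ^ i M / Y ^ (i + 1) M` are all isomorphic. -/
theorem layers_of_length_le {r t : ℕ} (hY : Y ^ r = 0) (ht0 : 0 < t)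
    (hle : Module.length R (M ⧸ LinearMap.range Y) ≤ t)
    (hge : ((r * t : ℕ) : ℕ∞) ≤ Module.length R M) :
    Module.length R M = ((r * t : ℕ) : ℕ∞) ∧
      ∃ N : Fin (r + 1) → Submodule R M, N 0 = ⊤ ∧ N (Fin.last r) = ⊥ ∧ StrictAnti N ∧
        (∀ i j : Fin r, Nonempty ((N i.castSucc ⧸ (N i.succ).submoduleOf (N i.castSucc)) ≃ₗ[R]
          (N j.castSucc ⧸ (N j.succ).submoduleOf (N j.castSucc)))) ∧
        ∀ i : Fin r, Module.length R
          (N i.castSucc ⧸ (N i.succ).submoduleOf (N i.castSucc)) = t := by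
  set N : ℕ → Submodule R M := fun i => LinearMap.range (Y ^ i) with hN
  have hb : ∀ i, Module.length R (N i ⧸ (N (i + 1)).submoduleOf (N i)) ≤ t := fun i =>
    (Module.length_le_of_surjective (toLayer Y i) (toLayer_surjective Y i)).trans hle
  have hab : ∀ i, Module.length R (N (i + 1)) + Module.length R
      (N i ⧸ (N (i + 1)).submoduleOf (N i)) = Module.length R (N i) :=
    fun i => Module.length_quotient_submoduleOf_add (range_pow_succ_le Y i)
  have h0 : N 0 = ⊤ := by simp [hN, Module.End.one_eq_id]
  have hr : N r = ⊥ := by simp [hN, hY]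
  -- Upper bounds propagate upwards from `N r = ⊥`, one layer of length at most `t` at a time.
  have hupper : ∀ d i, i + d = r → Module.length R (N i) ≤ ((d * t : ℕ) : ℕ∞) := by
    intro d
    induction d with
    | zero => intro i hi; obtain rfl : i = r := hi; rw [hr]; simp
    | succ d ih =>
      intro i hi
      rw [← hab, add_mul, one_mul]
      push_cast
      exact add_le_add (by exact_mod_cast ih (i + 1) (by omega)) (hb i)
  -- Lower bounds propagate downwards from `N 0 = ⊤`: passing to the next term loses at most `t`.
  -- Both bounds meet.
  have hlen : ∀ i, ∀ d, i + d = r → Module.length R (N i) = ((d * t : ℕ) : ℕ∞) := by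
    intro i
    induction i with
    | zero =>
      intro d hd
      refine le_antisymm (hupper d 0 hd) ?_
      obtain rfl : d = r := by omega
      rwa [h0, Module.length_top]
    | succ i ih =>
      intro d hd
      refine le_antisymm (hupper d _ hd) ?_
      have h1 := ih (d + 1) (by omega)
      have h2 := hb i
      rw [← hab] at h1
      generalize Module.length R (N (i + 1)) = a at *
      generalize Module.length R (N i ⧸ (N (i + 1)).submoduleOf (N i)) = b at *
      lift b to ℕ using (ne_top_of_le_ne_top (ENat.natCast_ne_top _) h2)
      rcases eq_or_ne a ⊤ with rfl | ha
      · simp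
      lift a to ℕ using ha
      norm_cast at h1 h2 ⊢
      rw [add_mul] at h1
      omega
  have hlayer : ∀ i, i < r → Module.length R (N i ⧸ (N (i + 1)).submoduleOf (N i)) = t := by
    intro i hi
    have h1 := hlen i (r - i - 1 + 1) (by omega)
    have h2 := hlen (i + 1) (r - i - 1) (by omega)
    rw [← hab, h2] at h1
    generalize Module.length R (N i ⧸ (N (i + 1)).submoduleOf (N i)) = b at *
    rcases eq_or_ne b ⊤ with rfl | hb'
    · simp at h1; exact absurd h1.symm (ENat.natCast_ne_top _)
    lift b to ℕ using hb'
    norm_cast at h1 ⊢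
    rw [add_mul] at h1
    omega
  -- A surjection from a module of length at most `t` onto one of length exactly `t` has zero
  -- kernel.
  have hequiv : ∀ i, i < r → Nonempty ((M ⧸ LinearMap.range Y) ≃ₗ[R]
      (N i ⧸ (N (i + 1)).submoduleOf (N i))) := fun i hi =>
    ⟨LinearEquiv.ofBijective (toLayer Y i) ⟨LinearMap.injective_of_surjective_of_length_le
      (toLayer_surjective Y i) (hle.trans (hlayer i hi).ge)
      (by rw [hlayer i hi]; exact ENat.natCast_ne_top _), toLayer_surjective Y i⟩⟩
  refine ⟨?_, fun i => N i, h0, hr, ?_, ?_, fun i => hlayer i i.isLt⟩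
  · rw [← hlen 0 r (by simp), h0, Module.length_top]
  · refine Fin.strictAnti_iff_succ_lt.2 fun i => lt_of_le_of_ne (range_pow_succ_le Y i) fun h => ?_
    have h1 := hlayer i i.isLt
    change N (i + 1) = N i at h
    rw [h, Submodule.submoduleOf_self, Module.length_eq_zero] at h1
    exact ht0.ne (by exact_mod_cast h1)
  · rintro i j
    obtain ⟨e⟩ := hequiv i i.isLt
    obtain ⟨e'⟩ := hequiv j j.isLt
    exact ⟨e.symm.trans e'⟩

end Layers

/-- Preimages under the surjection embed the lattice of submodules of `N` into that of `M`. This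
compares lengths over Ariki-Koike and group algebras, along both `proj` and `sec`. -/
theorem Module.length_le_of_semilinear {R S M N : Type*} [Ring R] [Ring S] [AddCommGroup M]
    [AddCommGroup N] [Module R M] [Module S N] {σ : R →+* S} (f : M →ₛₗ[σ] N)
    (hf : Function.Surjective f) : Module.length S N ≤ Module.length R M := by
  rw [← WithBot.coe_le_coe, Module.coe_length, Module.coe_length]
  refine Order.krullDim_le_of_strictMono (Submodule.comap f)
    (Monotone.strictMono_of_injective (fun _ _ h => Submodule.comap_mono h) ?_)
  intro p p' h
  ext x
  obtain ⟨x, rfl⟩ := hf x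
  rw [← Submodule.mem_comap, h, Submodule.mem_comap]

namespace ArikiKoike

/-! ### The module `W ⊗ K[y] / (y ^ r)` -/

section TruncatedModule

variable {K : Type*} [Field K] {r n : ℕ} {W : Type*} [AddCommGroup W] [Module K W]

/-- The operator `P ⊗ y` on `W ⊗ K[y] / (y ^ r)`. -/
def shiftMap (r : ℕ) (P : W →ₗ[K] W) : Module.End K (Fin r → W) where
  toFun f i := if i.val = 0 then 0 else P (f ⟨i.val - 1, (Nat.sub_le _ _).trans_lt i.isLt⟩)
  map_add' f g := by
    ext i
    by_cases h : i.val = 0 <;> simp [h]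
  map_smul' a f := by
    ext i
    by_cases h : i.val = 0 <;> simp [h]

theorem shiftMap_apply (P : W →ₗ[K] W) (f : Fin r → W) (i : Fin r) : shiftMap r P f i =
    if i.val = 0 then 0 else P (f ⟨i.val - 1, (Nat.sub_le _ _).trans_lt i.isLt⟩) := rfl

theorem shiftMap_pow (P : W →ₗ[K] W) : shiftMap r P ^ r = 0 := by
  have key : ∀ m (f : Fin r → W) (i : Fin r), i.val < m → (shiftMap r P ^ m) f i = 0 := by
    intro m
    induction m with
    | zero => intro f i hi; omega
    | succ m ih =>
      intro f i hi
      rw [pow_succ', Module.End.mul_apply, shiftMap_apply]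
      split_ifs with h
      · rfl
      · rw [ih _ _ (by simp only; omega), map_zero]
  refine LinearMap.ext fun f => funext fun i => ?_
  exact key r _ i i.isLt

theorem shiftMap_comm {P P' : W →ₗ[K] W} (h : ∀ x, P (P' x) = P' (P x)) :
    shiftMap r P * shiftMap r P' = shiftMap r P' * shiftMap r P := by
  refine LinearMap.ext fun f => funext fun i => ?_
  simp only [Module.End.mul_apply, shiftMap_apply, apply_ite P, apply_ite P', map_zero, h]

variable [Module (MonoidAlgebra K (Equiv.Perm (Fin n)))ᵐᵒᵖ W]
  [IsScalarTower K (MonoidAlgebra K (Equiv.Perm (Fin n)))ᵐᵒᵖ W]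

variable (r W) in
/-- The action of the group algebra on `W ⊗ K[y] / (y ^ r)`. -/
noncomputable def groupAct : (MonoidAlgebra K (Equiv.Perm (Fin n)))ᵐᵒᵖ →ₐ[K]
    Module.End K (Fin r → W) :=
  Algebra.lsmul K K (Fin r → W)

variable (r W) in
/-- The action of a permutation on `W ⊗ K[y] / (y ^ r)`. -/
noncomputable def permAct (v : Equiv.Perm (Fin n)) : Module.End K (Fin r → W) :=
  groupAct r W (MulOpposite.op (MonoidAlgebra.of K _ v))

theorem permAct_apply (v : Equiv.Perm (Fin n)) (f : Fin r → W) (i : Fin r) :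
    permAct (K := K) r W v f i = MulOpposite.op (MonoidAlgebra.of K _ v) • f i := rfl

theorem permAct_mul (v w : Equiv.Perm (Fin n)) :
    permAct (K := K) r W (v * w) = permAct r W w * permAct r W v := by
  rw [permAct, map_mul, MulOpposite.op_mul, map_mul]
  rfl

theorem permAct_one : permAct (K := K) (n := n) r W 1 = 1 := by
  rw [permAct, map_one, MulOpposite.op_one, map_one]

variable {P : Fin n → W →ₗ[K] W}

/-- The hypothesis `hP` says that the right action of `v` intertwines `P j` with `P (v j)`, the same
rule by which `T_w` moves the elements `L_k - c`. -/
theorem shiftMap_mul_permAct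
    (hP : ∀ (v : Equiv.Perm (Fin n)) j x, P j (MulOpposite.op (MonoidAlgebra.of K _ v) • x) =
      MulOpposite.op (MonoidAlgebra.of K _ v) • P (v j) x) (v : Equiv.Perm (Fin n)) (j : Fin n) :
    shiftMap r (P j) * permAct r W v = permAct r W v * shiftMap r (P (v j)) := by
  refine LinearMap.ext fun f => funext fun i => ?_
  simp only [Module.End.mul_apply, shiftMap_apply, permAct_apply, hP]
  split_ifs
  · rw [smul_zero]
  · rfl

variable {Q : Fin r → Kˣ} {c : K}

/-- The module is built so that `L_k - c` acts as `P_k ⊗ y`. The cyclotomic relation holds since `y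
^ r = 0`, the four-term relation since `P_0` and `P_1` commute, and `T_0` commutes with `T_j` for `j
≥ 2` since `s_j` fixes the index `0`. -/
theorem lift_truncFun (hc : ∀ j, (Q j : K) = c)
    (hP : ∀ (v : Equiv.Perm (Fin n)) j x, P j (MulOpposite.op (MonoidAlgebra.of K _ v) • x) =
      MulOpposite.op (MonoidAlgebra.of K _ v) • P (v j) x)
    (hPc : ∀ j k x, P j (P k x) = P k (P j x)) :
    ∀ x y, Relation 1 Q n x y →
      FreeAlgebra.lift K (fun i : Fin n => MulOpposite.op (if i.val = 0 then
        algebraMap K _ c + shiftMap r (P i) else permAct r W (simpleTransposition i))) x =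
      FreeAlgebra.lift K (fun i : Fin n => MulOpposite.op (if i.val = 0 then
        algebraMap K _ c + shiftMap r (P i) else permAct r W (simpleTransposition i))) y := by
  have hs := symRelations_simpleTranspositionNat n
  intro x y h
  apply MulOpposite.unop_injective
  cases h with
  | cyclotomic h0 =>
    simp only [hc, List.map_const', List.prod_replicate, List.length_finRange, map_pow, map_sub,
      FreeAlgebra.lift_ι_apply, if_true, AlgHom.commutes, MulOpposite.algebraMap_apply, map_zero,
      MulOpposite.unop_pow, MulOpposite.unop_sub, MulOpposite.unop_op, add_sub_cancel_left,
      shiftMap_pow, MulOpposite.unop_zero]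
  | quadratic i h0 =>
    have := hs.sq i h0 i.isLt
    simp only [simpleTranspositionNat, i.isLt, dif_pos, Fin.eta] at this
    simp only [map_mul, map_sub, map_add, FreeAlgebra.lift_ι_apply, if_neg h0.ne',
      Units.val_one, map_one, map_zero, MulOpposite.unop_mul, MulOpposite.unop_sub,
      MulOpposite.unop_add, MulOpposite.unop_op, MulOpposite.unop_one, MulOpposite.unop_zero]
    rw [add_mul, mul_sub, ← permAct_mul, this, permAct_one]
    noncomm_ring
  | braidFour i j hi hj =>
    have hsq := hs.sq j (by omega) j.isLt
    simp only [simpleTranspositionNat, j.isLt, dif_pos, Fin.eta] at hsq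
    have hj0 : j.val ≠ 0 := by omega
    have ha : permAct (K := K) r W (simpleTransposition j) * permAct r W (simpleTransposition j) =
        (1 : Module.End K (Fin r → W)) := by rw [← permAct_mul, hsq, permAct_one]
    have hi' : simpleTransposition j i = j := by
      rw [simpleTransposition_apply, if_pos (by omega)]
    have hp := shiftMap_mul_permAct (K := K) (r := r) hP (simpleTransposition j) i
    rw [hi'] at hp
    have hpc : shiftMap r (P i) * shiftMap r (P j) = shiftMap r (P j) * shiftMap r (P i) :=
      shiftMap_comm (hPc i j)
    simp only [map_mul, FreeAlgebra.lift_ι_apply, if_pos hi, if_neg hj0,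
      MulOpposite.unop_mul, MulOpposite.unop_op]
    have hcomm : ∀ z : Module.End K (Fin r → W), algebraMap K _ c * z = z * algebraMap K _ c :=
      fun z => Algebra.commutes _ _
    generalize permAct (K := K) r W (simpleTransposition j) = a at *
    generalize shiftMap r (P i) = p at *
    generalize shiftMap r (P j) = p' at *
    generalize algebraMap K (Module.End K (Fin r → W)) c = d at *
    -- Conjugation by `s_1` turns `P_0` into `P_1`, so the four-term relation reduces to the
    -- commutation of `d + p` and `d + p'`.
    have h1 : a * (d + p) * a = d + p' := by
      rw [mul_add, add_mul, ← hcomm, mul_assoc, mul_assoc, ha, hp, ← mul_assoc, ha, mul_one,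
        one_mul]
    calc a * ((d + p) * (a * (d + p))) = a * (d + p) * a * (d + p) := by simp only [mul_assoc]
      _ = (d + p) * (a * (d + p) * a) := by
        rw [h1, mul_add, add_mul, add_mul, mul_add, add_mul, add_mul, hpc, hcomm p', hcomm p]
        abel
      _ = (d + p) * (a * ((d + p) * a)) := by simp only [mul_assoc]
  | braidThree i j hi hj =>
    have := hs.braid i hi (by rw [← hj]; exact j.isLt)
    simp only [← hj, simpleTranspositionNat, i.isLt, j.isLt, dif_pos, Fin.eta] at this
    simp only [map_mul, FreeAlgebra.lift_ι_apply, if_neg hi.ne', hj, Nat.succ_ne_zero, if_false,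
      MulOpposite.unop_mul, MulOpposite.unop_op]
    rw [← permAct_mul, ← permAct_mul, ← permAct_mul, ← permAct_mul, this]
  | comm i j hij =>
    have hj : j.val ≠ 0 := by omega
    simp only [map_mul, FreeAlgebra.lift_ι_apply, if_neg hj, MulOpposite.unop_mul,
      MulOpposite.unop_op]
    split_ifs with hi
    · have hp := shiftMap_mul_permAct (r := r) hP (simpleTransposition j) i
      rw [simpleTransposition_apply, if_neg (by omega), if_neg (by omega)] at hp
      rw [mul_add, add_mul, Algebra.commutes, hp]
    · have := hs.comm i j (Nat.pos_of_ne_zero hi) hij j.isLt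
      simp only [simpleTranspositionNat, i.isLt, j.isLt, dif_pos, Fin.eta] at this
      rw [← permAct_mul, this, permAct_mul]

/-- The right action of `H_n` on `W ⊗ K[y] / (y ^ r)` in which `T_0` acts by `c + P_0 ⊗ y`. -/
noncomputable def truncAct (hc : ∀ j, (Q j : K) = c)
    (hP : ∀ (v : Equiv.Perm (Fin n)) j x, P j (MulOpposite.op (MonoidAlgebra.of K _ v) • x) =
      MulOpposite.op (MonoidAlgebra.of K _ v) • P (v j) x)
    (hPc : ∀ j k x, P j (P k x) = P k (P j x)) :
    ArikiKoike 1 Q n →ₐ[K] (Module.End K (Fin r → W))ᵐᵒᵖ :=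
  lift 1 Q _ (lift_truncFun hc hP hPc)

variable (hc : ∀ j, (Q j : K) = c)
    (hP : ∀ (v : Equiv.Perm (Fin n)) j x, P j (MulOpposite.op (MonoidAlgebra.of K _ v) • x) =
      MulOpposite.op (MonoidAlgebra.of K _ v) • P (v j) x)
    (hPc : ∀ j k x, P j (P k x) = P k (P j x))

theorem truncAct_T (i : Fin n) : truncAct hc hP hPc (T 1 Q i) =
    MulOpposite.op (if i.val = 0 then
        algebraMap K _ c + shiftMap r (P i) else permAct r W (simpleTransposition i)) :=
  lift_T ..

theorem truncAct_T_pos (i : Fin n) (h : 0 < i.val) : truncAct hc hP hPc (T 1 Q i) =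
    MulOpposite.op (permAct r W (simpleTransposition i)) := by
  rw [truncAct_T, if_neg h.ne']

theorem truncAct_sec (b : MonoidAlgebra K (Equiv.Perm (Fin n))) :
    truncAct hc hP hPc (sec Q n b) = MulOpposite.op (groupAct r W (MulOpposite.op b)) := by
  induction b using MonoidAlgebra.induction_on with
  | of w =>
    rw [sec_of]
    change _ = MulOpposite.op (permAct r W w)
    induction w using perm_induction with
    | one => rw [Tw_one, map_one, permAct_one, MulOpposite.op_one]
    | mul i w hi ih =>
      rw [Tw_mul, map_mul, ih, Tw_simpleTransposition i hi, truncAct_T_pos _ _ _ _ hi, permAct_mul,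
        MulOpposite.op_mul]
  | add a b ha hb => simp only [map_add, ha, hb, MulOpposite.op_add]
  | smul d a ha => simp only [map_smul, ha, MulOpposite.op_smul]

/-- For the first index this is the definition of the action of `T_0`; conjugation by the
transposition of `0` and `k` gives the rest. -/
theorem truncAct_nilJM (k : Fin n) :
    truncAct hc hP hPc (nilJM Q c k) = MulOpposite.op (shiftMap r (P k)) := by
  have h0 : truncAct hc hP hPc (nilJM Q c ⟨0, k.pos⟩) =
      MulOpposite.op (shiftMap r (P ⟨0, k.pos⟩)) := by
    rw [← add_right_cancel_iff (a := algebraMap K _ c), ← AlgHom.commutes (truncAct hc hP hPc) c,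
      ← map_add, ← nilJM_zero, truncAct_T, AlgHom.commutes, if_pos rfl, MulOpposite.op_add,
      add_comm]
    rfl
  set w : Equiv.Perm (Fin n) := Equiv.swap ⟨0, k.pos⟩ k
  have hw : w ⟨0, k.pos⟩ = k := Equiv.swap_apply_left _ _
  have h1 := Tw_mul_nilJM (Q := Q) (c := c) w ⟨0, k.pos⟩
  rw [hw] at h1
  have h2 : truncAct hc hP hPc (Tw 1 Q w) = MulOpposite.op (permAct r W w) := by
    rw [← sec_of, truncAct_sec]
    rfl
  have h3 : MulOpposite.op (permAct r W w) * MulOpposite.op (permAct r W w⁻¹) =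
      (1 : (Module.End K (Fin r → W))ᵐᵒᵖ) := by
    rw [← MulOpposite.op_mul, ← permAct_mul, mul_inv_cancel, permAct_one, MulOpposite.op_one]
  have h4 := congrArg (truncAct hc hP hPc) h1
  rw [map_mul, map_mul, h0, h2, ← MulOpposite.op_mul, shiftMap_mul_permAct hP, hw,
    MulOpposite.op_mul] at h4
  have h5 := congrArg (· * MulOpposite.op (permAct (K := K) r W w⁻¹)) h4
  simp only [mul_assoc, h3, mul_one] at h5
  exact h5.symm

variable (Q) in
/-- The right `H_n`-module `W ⊗ K[y] / (y ^ r)`. -/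
@[reducible]
noncomputable def truncModule : Module (ArikiKoike 1 Q n)ᵐᵒᵖ (Fin r → W) :=
  Module.compHom _ (AlgHom.opComm (truncAct hc hP hPc)).toRingHom

/-- The submodules `y ^ i (W ⊗ K[y] / (y ^ r))` of `W ⊗ K[y] / (y ^ r)`, together with the action
on their layers. -/
theorem truncAct_filtration (hr : 0 < r) (a : ArikiKoike 1 Q n) (i : ℕ) (f : Fin r → W)
    (hf : ∀ j : Fin r, j.val < i → f j = 0) :
    (∀ j : Fin r, j.val < i → (truncAct hc hP hPc a).unop f j = 0) ∧
      ∀ j : Fin r, j.val = i →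
        (truncAct hc hP hPc a).unop f j = MulOpposite.op (proj n hr hc a) • f j := by
  induction a using induction_on generalizing f with
  | scalar d =>
    rw [AlgHom.commutes, AlgHom.commutes]
    refine ⟨fun j hj => ?_, fun j hj => ?_⟩
    · change d • f j = 0
      rw [hf j hj, smul_zero]
    · change d • f j = _
      rw [← MulOpposite.algebraMap_apply, algebraMap_smul]
  | gen m =>
    rw [truncAct_T, proj_T]
    split_ifs with h
    -- The nilpotent part of `T_0` raises the `y`-degree, so `T_0` acts by `c` on the lowest
    -- possibly nonzero coefficient.
    · have hx : ∀ j : Fin r, j.val ≤ i →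
          (algebraMap K (Module.End K (Fin r → W)) c + shiftMap r (P m)) f j = c • f j := by
        intro j hj
        change c • f j + shiftMap r (P m) f j = c • f j
        rw [shiftMap_apply]
        split_ifs with h0
        · rw [add_zero]
        · rw [hf ⟨j.val - 1, _⟩ (show j.val - 1 < i by omega), map_zero, add_zero]
      refine ⟨fun j hj => ?_, fun j hj => ?_⟩
      · rw [MulOpposite.unop_op, hx j hj.le, hf j hj, smul_zero]
      · rw [MulOpposite.unop_op, hx j hj.le, ← MulOpposite.algebraMap_apply, algebraMap_smul]
    · refine ⟨fun j hj => ?_, fun j hj => rfl⟩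
      rw [MulOpposite.unop_op, permAct_apply, hf j hj, smul_zero]
  | add a b ha hb =>
    rw [map_add, map_add, MulOpposite.op_add]
    refine ⟨fun j hj => ?_, fun j hj => ?_⟩
    · change (truncAct hc hP hPc a).unop f j + (truncAct hc hP hPc b).unop f j = 0
      rw [(ha f hf).1 j hj, (hb f hf).1 j hj, add_zero]
    · change (truncAct hc hP hPc a).unop f j + (truncAct hc hP hPc b).unop f j = _
      rw [(ha f hf).2 j hj, (hb f hf).2 j hj, add_smul]
  | mul a b ha hb =>
    rw [map_mul, map_mul, MulOpposite.op_mul]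
    -- In a right action `a` acts before `b`, so the hypothesis for `b` is used at the image of `f`
    -- under `a`.
    have h1 := hb _ (ha f hf).1
    refine ⟨h1.1, fun j hj => ?_⟩
    rw [mul_smul, ← (ha f hf).2 j hj]
    exact h1.2 j hj

/-- The `y`-adic filtration has `r` layers, and the coefficient of `y ^ i` maps the `i`-th one onto
`W`, semilinearly along `proj`. -/
theorem length_truncModule (hr : 0 < r) {t : ℕ∞}
    (ht : Module.length (MonoidAlgebra K (Equiv.Perm (Fin n)))ᵐᵒᵖ W = t) :
    letI := truncModule Q hc hP hPc
    r * t ≤ Module.length (ArikiKoike 1 Q n)ᵐᵒᵖ (Fin r → W) := by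
  let _ := truncModule Q hc hP hPc
  let N : ℕ → Submodule (ArikiKoike 1 Q n)ᵐᵒᵖ (Fin r → W) := fun i =>
    { carrier := {f | ∀ j : Fin r, j.val < i → f j = 0}
      zero_mem' := fun j _ => rfl
      add_mem' := fun {f g} hf hg j hj => by rw [Pi.add_apply, hf j hj, hg j hj, add_zero]
      smul_mem' := fun a f hf => (truncAct_filtration hc hP hPc hr a.unop i f hf).1 }
  have h0 : N 0 = ⊤ := top_unique fun f _ j hj => absurd hj (Nat.not_lt_zero _)
  rw [← Module.length_top, ← h0]
  refine Module.le_length_of_chain (fun i _ f hf j hj => hf j (by omega)) fun i hi => ?_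
  rw [← ht]
  let ev : N i →ₛₗ[RingHom.op (proj n hr hc).toRingHom] W :=
    { toFun := fun f => f.1 ⟨i, hi⟩
      map_add' := fun f g => rfl
      map_smul' := fun a f => (truncAct_filtration hc hP hPc hr a.unop i f.1 f.2).2 _ rfl }
  refine Module.length_le_of_semilinear (((N (i + 1)).submoduleOf (N i)).liftQ ev ?_) ?_
  · intro f hf
    exact hf ⟨i, hi⟩ (Nat.lt_succ_self i)
  · intro x
    refine ⟨Submodule.Quotient.mk (⟨Pi.single ⟨i, hi⟩ x, fun j hj => ?_⟩ : N i), ?_⟩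
    · rw [Pi.single_eq_of_ne]
      rintro rfl
      exact hj.ne rfl
    · change (Pi.single (⟨i, hi⟩ : Fin r) x : Fin r → W) ⟨i, hi⟩ = x
      rw [Pi.single_eq_same]

end TruncatedModule

end ArikiKoike

/-! ### Coset projections of modules induced from `K[S_n]` to `K[S_{n+1}]` -/

namespace SymGroupAlg

variable {K : Type*} [Field K] {n : ℕ}

/-- The additive map `K[G] → B` with `a w ↦ a g(w)`. -/
noncomputable def extendAdd {G B : Type*} [Group G] [Ring B] [Algebra K B] (g : G → B) :
    MonoidAlgebra K G →+ B :=
  MonoidAlgebra.liftNC (algebraMap K B : K →+ B) g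

theorem extendAdd_of {G B : Type*} [Group G] [Ring B] [Algebra K B] (g : G → B) (w : G) :
    extendAdd (K := K) g (MonoidAlgebra.of K G w) = g w := by
  simp [extendAdd, MonoidAlgebra.liftNC_single]

theorem extendAdd_smul {G B : Type*} [Group G] [Ring B] [Algebra K B] (g : G → B) (d : K)
    (b : MonoidAlgebra K G) : extendAdd g (d • b) = d • extendAdd g b := by
  induction b using MonoidAlgebra.induction_linear with
  | zero => simp
  | add a b ha hb => rw [smul_add, map_add, ha, hb, map_add, smul_add]
  | single w a =>
    rw [MonoidAlgebra.smul_single]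
    simp [extendAdd, MonoidAlgebra.liftNC_single, Algebra.smul_def, mul_assoc]

variable (K n) in
/-- The part of an element of `K[S_{n+1}]` supported on the `w` with `w j = n + 1`. -/
noncomputable def cosetPart (j : Fin (n + 1)) :
    MonoidAlgebra K (Equiv.Perm (Fin (n + 1))) →+ MonoidAlgebra K (Equiv.Perm (Fin (n + 1))) :=
  extendAdd fun w => if w j = Fin.last n then MonoidAlgebra.of K _ w else 0

theorem cosetPart_of (j : Fin (n + 1)) (w : Equiv.Perm (Fin (n + 1))) :
    cosetPart K n j (MonoidAlgebra.of K _ w) =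
      if w j = Fin.last n then MonoidAlgebra.of K _ w else 0 :=
  extendAdd_of _ _

theorem cosetPart_smul (j : Fin (n + 1)) (d : K)
    (b : MonoidAlgebra K (Equiv.Perm (Fin (n + 1)))) :
    cosetPart K n j (d • b) = d • cosetPart K n j b :=
  extendAdd_smul _ _ _

theorem viaEmbedding_last (w : Equiv.Perm (Fin n)) :
    Equiv.Perm.viaEmbeddingHom Fin.castSuccEmb w (Fin.last n) = Fin.last n := by
  rw [Equiv.Perm.viaEmbeddingHom_apply]
  exact Equiv.Perm.viaEmbedding_apply_of_notMem _ _ _ (by simp)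

/-- The coset `S_n w` is determined by the preimage of the last point under `w`, which left
multiplication by `S_n` does not change. Hence the truncation descends to the induced module. -/
theorem cosetPart_incl_mul (j : Fin (n + 1)) (a : MonoidAlgebra K (Equiv.Perm (Fin n)))
    (b : MonoidAlgebra K (Equiv.Perm (Fin (n + 1)))) :
    cosetPart K n j (incl K n a * b) = incl K n a * cosetPart K n j b := by
  induction a using MonoidAlgebra.induction_on with
  | add a a' ha ha' => rw [map_add, add_mul, map_add, ha, ha', add_mul]
  | smul d a ha => rw [incl_smul, smul_mul_assoc, cosetPart_smul, ha, smul_mul_assoc]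
  | of v =>
    induction b using MonoidAlgebra.induction_on with
    | add b b' hb hb' => rw [mul_add, map_add, hb, hb', map_add, mul_add]
    | smul d b hb => rw [mul_smul_comm, cosetPart_smul, hb, cosetPart_smul, mul_smul_comm]
    | of w =>
      rw [incl_of, ← map_mul, cosetPart_of, cosetPart_of, Equiv.Perm.mul_apply]
      have : Equiv.Perm.viaEmbeddingHom Fin.castSuccEmb v (w j) = Fin.last n ↔
          w j = Fin.last n := by
        conv_lhs => rw [← viaEmbedding_last v]
        exact EmbeddingLike.apply_eq_iff_eq _
      simp only [this]
      split_ifs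
      · rw [map_mul]
      · rw [mul_zero]

theorem cosetPart_mul_of (j : Fin (n + 1)) (v : Equiv.Perm (Fin (n + 1)))
    (b : MonoidAlgebra K (Equiv.Perm (Fin (n + 1)))) :
    cosetPart K n j (b * MonoidAlgebra.of K _ v) =
      cosetPart K n (v j) b * MonoidAlgebra.of K _ v := by
  induction b using MonoidAlgebra.induction_on with
  | add b b' hb hb' => rw [add_mul, map_add, hb, hb', map_add, add_mul]
  | smul d b hb => rw [smul_mul_assoc, cosetPart_smul, hb, cosetPart_smul, smul_mul_assoc]
  | of w =>
    rw [← map_mul, cosetPart_of, cosetPart_of, Equiv.Perm.mul_apply]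
    split_ifs
    · rw [map_mul]
    · rw [zero_mul]

theorem cosetPart_comm (j k : Fin (n + 1)) (b : MonoidAlgebra K (Equiv.Perm (Fin (n + 1)))) :
    cosetPart K n j (cosetPart K n k b) = cosetPart K n k (cosetPart K n j b) := by
  induction b using MonoidAlgebra.induction_on with
  | add b b' hb hb' => simp only [map_add, hb, hb']
  | smul d b hb => simp only [cosetPart_smul, hb]
  | of w =>
    rw [cosetPart_of, cosetPart_of, apply_ite (cosetPart K n j), apply_ite (cosetPart K n k),
      cosetPart_of, cosetPart_of, map_zero, map_zero]
    split_ifs <;> rfl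

/-! ### Retraction of `K[S_{n+1}]` onto `K[S_n]`. -/

variable (K n) in
/-- The part of an element of `K[S_{n+1}]` supported on `S_n`. -/
noncomputable def restrictPart :
    MonoidAlgebra K (Equiv.Perm (Fin (n + 1))) →+ MonoidAlgebra K (Equiv.Perm (Fin n)) :=
  open Classical in
  extendAdd fun w => if h : ∃ v, Equiv.Perm.viaEmbeddingHom Fin.castSuccEmb v = w then
    MonoidAlgebra.of K _ h.choose else 0

theorem restrictPart_of_embedding (v : Equiv.Perm (Fin n)) :
    restrictPart K n (MonoidAlgebra.of K _ (Equiv.Perm.viaEmbeddingHom Fin.castSuccEmb v)) =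
      MonoidAlgebra.of K _ v := by
  have h : ∃ v', Equiv.Perm.viaEmbeddingHom Fin.castSuccEmb v' =
    Equiv.Perm.viaEmbeddingHom Fin.castSuccEmb v := ⟨v, rfl⟩
  rw [restrictPart, extendAdd_of, dif_pos h,
    Equiv.Perm.viaEmbeddingHom_injective _ h.choose_spec]

theorem restrictPart_of_notMem {w : Equiv.Perm (Fin (n + 1))}
    (h : ¬ ∃ v, Equiv.Perm.viaEmbeddingHom Fin.castSuccEmb v = w) :
    restrictPart K n (MonoidAlgebra.of K _ w) = 0 := by
  rw [restrictPart, extendAdd_of, dif_neg h]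

theorem restrictPart_incl_mul (a : MonoidAlgebra K (Equiv.Perm (Fin n)))
    (b : MonoidAlgebra K (Equiv.Perm (Fin (n + 1)))) :
    restrictPart K n (incl K n a * b) = a * restrictPart K n b := by
  have hs : ∀ (d : K) b, restrictPart K n (d • b) = d • restrictPart K n b :=
    fun d b => extendAdd_smul _ _ _
  induction a using MonoidAlgebra.induction_on with
  | add a a' ha ha' => rw [map_add, add_mul, map_add, ha, ha', add_mul]
  | smul d a ha => rw [incl_smul, smul_mul_assoc, hs, ha, smul_mul_assoc]
  | of v =>
    induction b using MonoidAlgebra.induction_on with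
    | add b b' hb hb' => rw [mul_add, map_add, hb, hb', map_add, mul_add]
    | smul d b hb => rw [mul_smul_comm, hs, hb, hs, mul_smul_comm]
    | of w =>
      rw [incl_of, ← map_mul]
      by_cases h : ∃ v', Equiv.Perm.viaEmbeddingHom Fin.castSuccEmb v' = w
      · obtain ⟨v', rfl⟩ := h
        rw [← map_mul, restrictPart_of_embedding, restrictPart_of_embedding, map_mul]
      · rw [restrictPart_of_notMem h, restrictPart_of_notMem, mul_zero]
        rintro ⟨v', hv'⟩
        exact h ⟨v⁻¹ * v', by rw [map_mul, hv', map_inv, inv_mul_cancel_left]⟩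

variable {E : Type*} [AddCommGroup E] [Module (MonoidAlgebra K (Equiv.Perm (Fin n)))ᵐᵒᵖ E]

/-- Needed to see that inducing a nonzero module gives a nonzero module, hence `t > 0`. -/
theorem unit_injective :
    Function.Injective (InducedModule.unit (RingHom.op (incl K n)) E) := by
  refine InducedModule.unit_injective
    ((MulOpposite.opAddEquiv.toAddMonoidHom.comp (restrictPart K n)).comp
      MulOpposite.opAddEquiv.symm.toAddMonoidHom) ?_ ?_
  · refine congrArg MulOpposite.op (?_ : restrictPart K n 1 = 1)
    have := restrictPart_of_embedding (K := K) (1 : Equiv.Perm (Fin n))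
    rwa [map_one (Equiv.Perm.viaEmbeddingHom _), map_one (MonoidAlgebra.of K _),
      map_one (MonoidAlgebra.of K _)] at this
  · intro s a
    exact congrArg MulOpposite.op (restrictPart_incl_mul a.unop s.unop)

variable (K n E) in
/-- The projection of the induced module onto the `j`-th coset component. -/
noncomputable def cosetProjAdd (j : Fin (n + 1)) : Ind K n E →+ Ind K n E :=
  InducedModule.liftAdd ((AddMonoidHom.compHom.flip (InducedModule.unit _ E)).comp
    (AddMonoidHom.smul.comp ((MulOpposite.opAddEquiv.toAddMonoidHom.comp (cosetPart K n j)).comp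
      MulOpposite.opAddEquiv.symm.toAddMonoidHom))) (by
    intro s a x
    change MulOpposite.op (cosetPart K n j (incl K n a.unop * s.unop)) •
        InducedModule.unit (RingHom.op (incl K n)) E x =
      MulOpposite.op (cosetPart K n j s.unop) •
        InducedModule.unit (RingHom.op (incl K n)) E (a • x)
    rw [cosetPart_incl_mul, InducedModule.unit_smul, MulOpposite.op_mul, mul_smul]
    rfl)

theorem cosetProjAdd_smul_unit (j : Fin (n + 1))
    (s : (MonoidAlgebra K (Equiv.Perm (Fin (n + 1))))ᵐᵒᵖ) (x : E) :
    cosetProjAdd K n E j (s • InducedModule.unit (RingHom.op (incl K n)) E x) =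
      MulOpposite.op (cosetPart K n j s.unop) •
        InducedModule.unit (RingHom.op (incl K n)) E x :=
  InducedModule.liftAdd_smul_unit _ _ _ _

variable (K n E) in
/-- The projection of the induced module onto the `j`-th coset component. -/
noncomputable def cosetProj (j : Fin (n + 1)) : Ind K n E →ₗ[K] Ind K n E where
  toFun := cosetProjAdd K n E j
  map_add' := map_add _
  map_smul' d z := by
    induction z using InducedModule.induction_on with
    | add a b ha hb => rw [smul_add, map_add, ha, hb, map_add, smul_add]
    | smul s x =>
      rw [← smul_assoc, cosetProjAdd_smul_unit, cosetProjAdd_smul_unit, MulOpposite.unop_smul,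
        cosetPart_smul, MulOpposite.op_smul, smul_assoc]
      rfl

theorem cosetProj_smul_unit (j : Fin (n + 1))
    (s : (MonoidAlgebra K (Equiv.Perm (Fin (n + 1))))ᵐᵒᵖ) (x : E) :
    cosetProj K n E j (s • InducedModule.unit (RingHom.op (incl K n)) E x) =
      MulOpposite.op (cosetPart K n j s.unop) •
        InducedModule.unit (RingHom.op (incl K n)) E x :=
  cosetProjAdd_smul_unit _ _ _

theorem cosetProj_smul (v : Equiv.Perm (Fin (n + 1))) (j : Fin (n + 1)) (z : Ind K n E) :
    cosetProj K n E j (MulOpposite.op (MonoidAlgebra.of K _ v) • z) =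
      MulOpposite.op (MonoidAlgebra.of K _ v) • cosetProj K n E (v j) z := by
  induction z using InducedModule.induction_on with
  | add a b ha hb => rw [smul_add, map_add, ha, hb, map_add, smul_add]
  | smul s x =>
    rw [smul_smul, cosetProj_smul_unit, cosetProj_smul_unit, smul_smul, MulOpposite.unop_mul,
      MulOpposite.unop_op, cosetPart_mul_of, MulOpposite.op_mul]

theorem cosetProj_comm (j k : Fin (n + 1)) (z : Ind K n E) :
    cosetProj K n E j (cosetProj K n E k z) = cosetProj K n E k (cosetProj K n E j z) := by
  induction z using InducedModule.induction_on with
  | add a b ha hb => simp only [map_add, ha, hb]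
  | smul s x =>
    simp only [cosetProj_smul_unit, MulOpposite.unop_op]
    rw [cosetPart_comm]

/-- The generating copy of `E` lies in the component of the last index. So in the truncated module
only `L_{n+1} - c` moves it, as in the induced module of `D^λ`. -/
theorem cosetProj_unit (j : Fin (n + 1)) (x : E) :
    cosetProj K n E j (InducedModule.unit (RingHom.op (incl K n)) E x) =
      if j = Fin.last n then InducedModule.unit (RingHom.op (incl K n)) E x else 0 := by
  rw [← one_smul (MonoidAlgebra K (Equiv.Perm (Fin (n + 1))))ᵐᵒᵖ
    (InducedModule.unit (RingHom.op (incl K n)) E x), cosetProj_smul_unit, MulOpposite.unop_one,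
    ← map_one (MonoidAlgebra.of K _), cosetPart_of, Equiv.Perm.one_apply]
  split_ifs
  · rw [map_one, MulOpposite.op_one]
  · rw [MulOpposite.op_zero, zero_smul]

end SymGroupAlg

/-! ### The induced module of a module on which `T_0` acts by a scalar -/

namespace ArikiKoike

section Induction

variable {K : Type*} [Field K] {r n : ℕ} {Q : Fin r → Kˣ} {c : K}
  {D : Type*} [AddCommGroup D] [Module (ArikiKoike 1 Q n)ᵐᵒᵖ D]

variable (n Q D) in
/-- The canonical map from a module to the induced module. -/
noncomputable abbrev indUnit : D →+ Ind 1 Q n D :=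
  InducedModule.unit (RingHom.op (incl 1 Q n).toRingHom) D

theorem indUnit_smul (a : ArikiKoike 1 Q n) (d : D) :
    indUnit n Q D (MulOpposite.op a • d) = MulOpposite.op (incl 1 Q n a) • indUnit n Q D d :=
  InducedModule.unit_smul _ _

variable (n Q D) in
/-- The endomorphism `d ⊗ a ↦ d ⊗ (L_{n+1} - c) a` of the induced module. -/
noncomputable def indNil (c : K) :
    Ind 1 Q n D →ₗ[(ArikiKoike 1 Q (n + 1))ᵐᵒᵖ] Ind 1 Q n D :=
  InducedModule.lift
    ((DistribSMul.toAddMonoidHom _ (MulOpposite.op (nilJM Q c (Fin.last n)))).comp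
      (indUnit n Q D)) (by
    intro a x
    change MulOpposite.op (nilJM Q c (Fin.last n)) • indUnit n Q D (a • x) =
      MulOpposite.op (incl 1 Q n a.unop) •
        MulOpposite.op (nilJM Q c (Fin.last n)) • indUnit n Q D x
    rw [← MulOpposite.op_unop a, indUnit_smul, smul_smul, smul_smul, ← MulOpposite.op_mul,
      ← MulOpposite.op_mul]
    congr 2
    -- Balancedness amounts to `L_{n+1}` commuting with the image of `H_n`.
    have h := jm_last_mul_incl (Q := Q) a.unop
    rw [nilJM, sub_mul, mul_sub, Algebra.commutes]
    exact congrArg (· - _) h.symm)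

theorem indNil_indUnit (d : D) : indNil n Q D c (indUnit n Q D d) =
    MulOpposite.op (nilJM Q c (Fin.last n)) • indUnit n Q D d :=
  InducedModule.lift_unit _ _ _

theorem indNil_pow_indUnit (m : ℕ) (d : D) : (indNil n Q D c ^ m) (indUnit n Q D d) =
    MulOpposite.op (nilJM Q c (Fin.last n)) ^ m • indUnit n Q D d := by
  induction m with
  | zero => simp
  | succ m ih =>
    rw [pow_succ', Module.End.mul_apply, ih, map_smul, indNil_indUnit, smul_smul, pow_succ]

theorem indNil_pow (hc : ∀ j, (Q j : K) = c) : indNil n Q D c ^ r = 0 := by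
  refine LinearMap.ext fun z => ?_
  induction z using InducedModule.induction_on with
  | add a b ha hb => rw [map_add, ha, hb, map_add]
  | smul s x =>
    rw [map_smul]
    change s • (indNil n Q D c ^ r) (indUnit n Q D x) = 0
    rw [indNil_pow_indUnit, ← MulOpposite.op_pow, nilJM_pow hc, MulOpposite.op_zero, zero_smul,
      smul_zero]

variable {E : Type*} [AddCommGroup E] [Module (MonoidAlgebra K (Equiv.Perm (Fin n)))ᵐᵒᵖ E]

theorem nilJM_smul_eq_zero {hr : 0 < r} {hc : ∀ j, (Q j : K) = c} (e : D ≃+ E)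
    (he : ∀ a d, e (MulOpposite.op a • d) = MulOpposite.op (proj n hr hc a) • e d)
    (k : Fin n) (d : D) : MulOpposite.op (nilJM Q c k) • d = 0 := by
  apply e.injective
  rw [he, proj_nilJM, MulOpposite.op_zero, zero_smul, map_zero]

theorem nilJM_castSucc_smul_indUnit {hr : 0 < r} {hc : ∀ j, (Q j : K) = c} (e : D ≃+ E)
    (he : ∀ a d, e (MulOpposite.op a • d) = MulOpposite.op (proj n hr hc a) • e d)
    (k : Fin n) (d : D) : MulOpposite.op (nilJM Q c k.castSucc) • indUnit n Q D d = 0 := by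
  have : nilJM Q c k.castSucc = incl 1 Q n (nilJM Q c k) := by
    rw [nilJM, nilJM, map_sub, incl_jm, AlgHom.commutes]
    rfl
  rw [this, ← indUnit_smul, nilJM_smul_eq_zero e he, map_zero]

/-- On the classes of `1 ⊗ d`, `L_{n+1} - c` vanishes modulo the range and the other `L_k - c`
vanish because they already kill `D`. Elements of `H_{n+1}` therefore act on these generators
through `K[S_{n+1}]`, and the quotient is an image of `Ind E`. -/
theorem length_quotient_range_indNil_le {hr : 0 < r} {hc : ∀ j, (Q j : K) = c} (e : D ≃+ E)
    (he : ∀ a d, e (MulOpposite.op a • d) = MulOpposite.op (proj n hr hc a) • e d) :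
    Module.length (ArikiKoike 1 Q (n + 1))ᵐᵒᵖ
        (Ind 1 Q n D ⧸ LinearMap.range (indNil n Q D c)) ≤
      Module.length (MonoidAlgebra K (Equiv.Perm (Fin (n + 1))))ᵐᵒᵖ (SymGroupAlg.Ind K n E) := by
  let Z := Ind 1 Q n D ⧸ LinearMap.range (indNil n Q D c)
  let π : Ind 1 Q n D →ₗ[(ArikiKoike 1 Q (n + 1))ᵐᵒᵖ] Z := (LinearMap.range (indNil n Q D c)).mkQ
  -- Restricting scalars along `sec` lets the universal property of `Ind E` produce the map.
  let _ : Module (MonoidAlgebra K (Equiv.Perm (Fin (n + 1))))ᵐᵒᵖ Z :=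
    Module.compHom Z (RingHom.op (sec Q (n + 1)).toRingHom)
  have hs : ∀ (b : MonoidAlgebra K (Equiv.Perm (Fin (n + 1)))) (z : Z),
    MulOpposite.op b • z = MulOpposite.op (sec Q (n + 1) b) • z := fun b z => rfl
  have hsym : ∀ (b : MonoidAlgebra K (Equiv.Perm (Fin n))) (x : E),
      e.symm (MulOpposite.op b • x) = MulOpposite.op (sec Q n b) • e.symm x := by
    intro b x
    apply e.injective
    rw [he, proj_sec, e.apply_symm_apply, e.apply_symm_apply]
  let g : E →+ Z := (π.toAddMonoidHom.comp (indUnit n Q D)).comp e.symm.toAddMonoidHom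
  have hg : ∀ (a : (MonoidAlgebra K (Equiv.Perm (Fin n)))ᵐᵒᵖ) (x : E),
      g (a • x) = RingHom.op (SymGroupAlg.incl K n) a • g x := by
    intro a x
    change π (indUnit n Q D (e.symm (MulOpposite.op a.unop • x))) =
      MulOpposite.op (SymGroupAlg.incl K n a.unop) • π (indUnit n Q D (e.symm x))
    rw [hsym, indUnit_smul, map_smul, hs, incl_sec]
  let ψ : SymGroupAlg.Ind K n E →ₛₗ[RingHom.op (sec Q (n + 1)).toRingHom] Z :=
    { toFun := InducedModule.lift g hg
      map_add' := map_add _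
      map_smul' := map_smul (InducedModule.lift g hg) }
  refine Module.length_le_of_semilinear ψ ?_
  have hnil : ∀ (a : ArikiKoike 1 Q (n + 1)), a ∈ nilIdeal Q (n + 1) c → ∀ d : D,
      MulOpposite.op a • π (indUnit n Q D d) = 0 := by
    intro a ha d
    induction ha using Submodule.span_induction with
    | zero => rw [MulOpposite.op_zero, zero_smul]
    | add x y _ _ hx hy => rw [MulOpposite.op_add, add_smul, hx, hy, add_zero]
    | smul b x _ hx =>
      change MulOpposite.op (x * b.unop) • π (indUnit n Q D d) = 0
      rw [MulOpposite.op_mul, mul_smul, hx, smul_zero]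
    | mem x hx =>
      obtain ⟨k, rfl⟩ := hx
      rw [← map_smul]
      induction k using Fin.lastCases with
      | last =>
        rw [← indNil_indUnit]
        exact (Submodule.Quotient.mk_eq_zero _).2 ⟨_, rfl⟩
      | cast k => rw [nilJM_castSucc_smul_indUnit e he, map_zero]
  intro z
  obtain ⟨z, rfl⟩ : ∃ z', π z' = z := (LinearMap.range (indNil n Q D c)).mkQ_surjective z
  induction z using InducedModule.induction_on with
  | add a b ha hb =>
    obtain ⟨x, hx⟩ := ha
    obtain ⟨y, hy⟩ := hb
    exact ⟨x + y, by rw [map_add, hx, hy, map_add]⟩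
  | smul s d =>
    refine ⟨MulOpposite.op (proj (n + 1) hr hc s.unop) •
      InducedModule.unit (RingHom.op (SymGroupAlg.incl K n)) E (e d), ?_⟩
    rw [map_smulₛₗ]
    change MulOpposite.op (sec Q (n + 1) (proj (n + 1) hr hc s.unop)) •
      InducedModule.lift g hg (InducedModule.unit (RingHom.op (SymGroupAlg.incl K n)) E (e d)) = _
    rw [InducedModule.lift_unit]
    change MulOpposite.op _ • π (indUnit n Q D (e.symm (e d))) = _
    rw [e.symm_apply_apply, map_smul, eq_comm, ← sub_eq_zero, ← sub_smul]
    exact hnil _ (sub_sec_proj_mem hr hc s.unop) d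

-- The rule `1 ⊗ d ↦ (1 ⊗ e d) y ^ 0` extends to a surjection onto `Ind E ⊗ K[y] / (y ^ r)`:
-- `K[S_{n+1}]` fills a degree from the copy of `E` in it, and `L_{n+1} - c` moves that copy one
-- degree up.
set_option maxHeartbeats 1000000 in
theorem le_length_ind (hr : 0 < r) {hc : ∀ j, (Q j : K) = c} (e : D ≃+ E)
    (he : ∀ a d, e (MulOpposite.op a • d) = MulOpposite.op (proj n hr hc a) • e d) {t : ℕ∞}
    (ht : Module.length (MonoidAlgebra K (Equiv.Perm (Fin (n + 1))))ᵐᵒᵖ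
      (SymGroupAlg.Ind K n E) = t) :
    r * t ≤ Module.length (ArikiKoike 1 Q (n + 1))ᵐᵒᵖ (Ind 1 Q n D) := by
  let P := SymGroupAlg.cosetProj K n E
  have hP : ∀ (v : Equiv.Perm (Fin (n + 1))) j x,
      P j (MulOpposite.op (MonoidAlgebra.of K _ v) • x) =
        MulOpposite.op (MonoidAlgebra.of K _ v) • P (v j) x := SymGroupAlg.cosetProj_smul
  have hPc : ∀ j k x, P j (P k x) = P k (P j x) := SymGroupAlg.cosetProj_comm
  let _ : Module (ArikiKoike 1 Q (n + 1))ᵐᵒᵖ (Fin r → SymGroupAlg.Ind K n E) :=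
    truncModule Q hc hP hPc
  refine (length_truncModule hc hP hPc hr ht).trans ?_
  have hact : ∀ (a : ArikiKoike 1 Q (n + 1)) (f : Fin r → SymGroupAlg.Ind K n E),
    MulOpposite.op a • f = (truncAct hc hP hPc a).unop f := fun a f => rfl
  let u : E →+ SymGroupAlg.Ind K n E := InducedModule.unit (RingHom.op (SymGroupAlg.incl K n)) E
  have hu : ∀ (b : MonoidAlgebra K (Equiv.Perm (Fin n))) x, u (MulOpposite.op b • x) =
    MulOpposite.op (SymGroupAlg.incl K n b) • u x := fun b x => InducedModule.unit_smul _ _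
  have hPu : ∀ j x, P j (u x) = if j = Fin.last n then u x else 0 := SymGroupAlg.cosetProj_unit
  let single : Fin r → SymGroupAlg.Ind K n E →+ (Fin r → SymGroupAlg.Ind K n E) := fun i =>
    AddMonoidHom.single (fun _ => SymGroupAlg.Ind K n E) i
  have hsingle : ∀ i (b : (MonoidAlgebra K (Equiv.Perm (Fin (n + 1))))ᵐᵒᵖ) w,
      groupAct (K := K) r _ b (single i w) = single i (b • w) :=
    fun i b w => (Pi.single_smul' i b w).symm
  have hshift : ∀ (j : Fin (n + 1)) x i (hi : i < r), shiftMap r (P j) (single ⟨i, hi⟩ (u x)) =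
      if h : i + 1 < r ∧ j = Fin.last n then single ⟨i + 1, h.1⟩ (u x) else 0 := by
    intro j x i hi
    funext m
    rw [shiftMap_apply]
    have hs : ∀ i m : Fin r, single i (u x) m = if m = i then u x else 0 := fun i m =>
      Pi.single_apply _ _ _
    rw [hs, apply_ite (P j), map_zero, hPu]
    have hm := m.isLt
    by_cases h : i + 1 < r ∧ j = Fin.last n
    · rw [dif_pos h, hs, if_pos h.2]
      simp only [Fin.ext_iff]
      split_ifs <;> first | rfl | omega
    · rw [dif_neg h, Pi.zero_apply]
      simp only [Fin.ext_iff]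
      rw [not_and_or] at h
      simp only [Fin.ext_iff] at h
      split_ifs <;> first | rfl | omega
  let g : D →+ (Fin r → SymGroupAlg.Ind K n E) :=
    (single ⟨0, hr⟩).comp (u.comp e.toAddMonoidHom)
  have hg : ∀ (a : (ArikiKoike 1 Q n)ᵐᵒᵖ) (x : D),
      g (a • x) = RingHom.op (incl 1 Q n).toRingHom a • g x := by
    intro a x
    obtain ⟨a, rfl⟩ := MulOpposite.op_surjective a
    change g (MulOpposite.op a • x) = MulOpposite.op (incl 1 Q n a) • g x
    induction a using induction_on generalizing x with
    | add a b ha hb =>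
      rw [MulOpposite.op_add, add_smul, map_add, ha, hb, map_add, MulOpposite.op_add, add_smul]
    | mul a b ha hb =>
      rw [MulOpposite.op_mul, mul_smul, hb, ha, map_mul, MulOpposite.op_mul, mul_smul]
    | scalar d =>
      change single ⟨0, hr⟩ (u (e (MulOpposite.op (algebraMap K _ d) • x))) =
        MulOpposite.op _ • single ⟨0, hr⟩ (u (e x))
      rw [he, hu, hact, AlgHom.commutes, AlgHom.commutes, AlgHom.commutes,
        Algebra.algebraMap_eq_smul_one, SymGroupAlg.incl_smul, map_one, ← Algebra.algebraMap_eq_smul_one,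
        ← MulOpposite.algebraMap_apply, ← hsingle, AlgHom.commutes]
      rfl
    | gen i =>
      change single ⟨0, hr⟩ (u (e (MulOpposite.op (T 1 Q i) • x))) =
        MulOpposite.op _ • single ⟨0, hr⟩ (u (e x))
      rw [he, hu, hact, incl_T, proj_T, truncAct_T, Fin.val_castSucc]
      split_ifs with h
      -- `T_0` comes from `H_n`, so its index is not the last one and its shift vanishes on the copy
      -- of `E`.
      · rw [MulOpposite.unop_op, LinearMap.add_apply, hshift, dif_neg, add_zero,
          Algebra.algebraMap_eq_smul_one, SymGroupAlg.incl_smul, map_one,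
          ← Algebra.algebraMap_eq_smul_one, ← MulOpposite.algebraMap_apply, ← hsingle,
          AlgHom.commutes]
        exact fun h' => (Fin.castSucc_lt_last i).ne h'.2
      · rw [MulOpposite.unop_op, SymGroupAlg.incl_of, viaEmbedding_castSucc_simpleTransposition,
          permAct, hsingle]
  refine Module.length_le_of_surjective (InducedModule.lift g hg)
    (InducedModule.lift_surjective g hg fun N hN => ?_)
  have hspan : ∀ i, (∀ x, single i (u x) ∈ N) → ∀ w, single i w ∈ N := by
    intro i hi w
    induction w using InducedModule.induction_on with
    | add a b ha hb => rw [map_add]; exact add_mem ha hb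
    | smul s x =>
      have := N.smul_mem (MulOpposite.op (sec Q (n + 1) s.unop)) (hi x)
      rw [hact, truncAct_sec, MulOpposite.unop_op, MulOpposite.op_unop, hsingle] at this
      exact this
  have hunit : ∀ i (hi : i < r) x, single ⟨i, hi⟩ (u x) ∈ N := by
    intro i
    induction i with
    | zero =>
      intro hi x
      obtain ⟨d, rfl⟩ := e.surjective x
      exact hN d
    | succ i ih =>
      intro hi x
      have := N.smul_mem (MulOpposite.op (nilJM Q c (Fin.last n))) (ih (by omega) x)
      rwa [hact, truncAct_nilJM, MulOpposite.unop_op, hshift, dif_pos ⟨hi, rfl⟩] at this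
  refine top_unique fun f _ => ?_
  rw [← Finset.univ_sum_single f]
  exact sum_mem fun i _ => hspan i (hunit i i.isLt) (f i)

/-- The structure of the induced module of a nonzero module pulled back from `K[S_n]`. -/
theorem ind_layers (hr : 0 < r) {hc : ∀ j, (Q j : K) = c} (e : D ≃+ E)
    (he : ∀ a d, e (MulOpposite.op a • d) = MulOpposite.op (proj n hr hc a) • e d)
    (hD : Nontrivial D) {t : ℕ}
    (ht : Module.length (MonoidAlgebra K (Equiv.Perm (Fin (n + 1))))ᵐᵒᵖ
      (SymGroupAlg.Ind K n E) = t) :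
    Module.length (ArikiKoike 1 Q (n + 1))ᵐᵒᵖ (Ind 1 Q n D) = ((r * t : ℕ) : ℕ∞) ∧
      ∃ M : Fin (r + 1) → Submodule (ArikiKoike 1 Q (n + 1))ᵐᵒᵖ (Ind 1 Q n D),
        M 0 = ⊤ ∧ M (Fin.last r) = ⊥ ∧ StrictAnti M ∧
        (∀ i j : Fin r, Nonempty
          ((M i.castSucc ⧸ (M i.succ).submoduleOf (M i.castSucc))
            ≃ₗ[(ArikiKoike 1 Q (n + 1))ᵐᵒᵖ]
              (M j.castSucc ⧸ (M j.succ).submoduleOf (M j.castSucc)))) ∧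
        ∀ i : Fin r, Module.length (ArikiKoike 1 Q (n + 1))ᵐᵒᵖ
          (M i.castSucc ⧸ (M i.succ).submoduleOf (M i.castSucc)) = t := by
  have hE : Nontrivial E := e.injective.nontrivial
  have hW : Nontrivial (SymGroupAlg.Ind K n E) :=
    (SymGroupAlg.unit_injective (K := K) (E := E)).nontrivial
  have ht0 : 0 < t := by
    have := Module.length_pos (R := (MonoidAlgebra K (Equiv.Perm (Fin (n + 1))))ᵐᵒᵖ)
      (M := SymGroupAlg.Ind K n E)
    rw [ht] at this
    exact_mod_cast this
  refine layers_of_length_le (indNil_pow hc) ht0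
    ((length_quotient_range_indNil_le e he).trans ht.le) ?_
  have := le_length_ind hr e he ht
  exact_mod_cast this

end Induction

end ArikiKoike

/-! ### Heads of cell modules as cyclic modules -/

section Cell

variable {K A : Type*} [Field K] [Ring A] [Algebra K A]

theorem mul_mem_cellIdeal_right {X : Set A} {z : A} (hz : z ∈ cellIdeal X) (a : A) :
    z * a ∈ cellIdeal X :=
  Submodule.smul_mem _ (MulOpposite.op a) hz

theorem mul_mem_cellIdeal_left {X : Set A} {z : A} (hz : z ∈ cellIdeal X) (a : A) :
    a * z ∈ cellIdeal X := by
  induction hz using Submodule.span_induction with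
  | zero => rw [mul_zero]; exact zero_mem _
  | add x y _ _ hx hy => rw [mul_add]; exact add_mem hx hy
  | smul b x _ hx =>
    have : a * b • x = (a * x) * b.unop := (mul_assoc _ _ _).symm
    rw [this]
    exact mul_mem_cellIdeal_right hx _
  | mem x hx =>
    obtain ⟨a', y, hy, rfl⟩ := hx
    exact Submodule.subset_span ⟨a * a', y, hy, (mul_assoc _ _ _).symm⟩

theorem subset_cellIdeal {X : Set A} {y : A} (hy : y ∈ X) : y ∈ cellIdeal X :=
  Submodule.subset_span ⟨1, y, hy, (one_mul y).symm⟩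

variable (star : A →ₐ[K] Aᵐᵒᵖ) (hstar : Function.Surjective star) (m : A) (X : Set A)

/-- The map `a ↦ m a` from `A` onto the quotient of the cell module by its radical. -/
def toCellHead : A →ₗ[Aᵐᵒᵖ] cellHead star hstar m X :=
  (cellRadical star hstar m X).mkQ.comp
    ((LinearMap.toSpanSingleton Aᵐᵒᵖ _ (⟨_, Submodule.subset_span rfl⟩ : cellModule m X)).comp
      ({ toFun := MulOpposite.op
         map_add' := fun _ _ => rfl
         map_smul' := fun _ _ => rfl } : A →ₗ[Aᵐᵒᵖ] Aᵐᵒᵖ))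

theorem toCellHead_surjective : Function.Surjective (toCellHead star hstar m X) := by
  refine (Submodule.mkQ_surjective (cellRadical star hstar m X)).comp ?_
  rintro ⟨x, hx⟩
  obtain ⟨a, rfl⟩ := Submodule.mem_span_singleton.1 hx
  exact ⟨a.unop, rfl⟩

theorem op_smul_op_smul_mkQ (a b : A) :
    MulOpposite.op (b * m) • MulOpposite.op a • (cellIdeal X).mkQ m =
      (cellIdeal X).mkQ (m * a * b * m) := by
  rw [← map_smul, ← map_smul]
  congr 1
  simp [mul_assoc]

theorem cellFormEq_zero_iff (a d : A) :
    MulOpposite.op ((star d).unop * m) • MulOpposite.op a • (cellIdeal X).mkQ m =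
      (cellIdeal X).mkQ ((0 : K) • m) ↔ m * a * (star d).unop * m ∈ cellIdeal X := by
  rw [op_smul_op_smul_mkQ, zero_smul, map_zero, Submodule.mkQ_apply,
    Submodule.Quotient.mk_eq_zero]

/-- Surjectivity of `star` removes it from the description of the radical: the head is `A` modulo
the right ideal of all `a` with `m a A m` inside the cell ideal. In this form heads over different
algebras can be compared. -/
theorem toCellHead_eq_zero_iff (a : A) :
    toCellHead star hstar m X a = 0 ↔ ∀ b, m * a * b * m ∈ cellIdeal X := by
  have key : toCellHead star hstar m X a = 0 ↔ ∀ y ∈ cellModule m X,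
      CellFormEq star m X (MulOpposite.op a • (cellIdeal X).mkQ m) y 0 :=
    Submodule.Quotient.mk_eq_zero (cellRadical star hstar m X)
  rw [key]
  constructor
  · intro h b
    obtain ⟨d, hd⟩ := hstar (MulOpposite.op b)
    have hmem : (cellIdeal X).mkQ (m * d) ∈ cellModule m X := by
      have : (cellIdeal X).mkQ (m * d) = MulOpposite.op d • (cellIdeal X).mkQ m := by
        rw [← map_smul]; rfl
      rw [this]
      exact Submodule.smul_mem _ _ (Submodule.subset_span rfl)
    have := (cellFormEq_zero_iff star m X a d).1 (h _ hmem d rfl)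
    rwa [hd] at this
  · intro h y hy b hb
    exact (cellFormEq_zero_iff star m X a b).2 (h _)

theorem cellHead_equiv_of_proj {B : Type*} [Ring B] [Algebra K B] (star' : B →ₐ[K] Bᵐᵒᵖ)
    (hstar' : Function.Surjective star') (m' : B) (X' : Set B) (π : A →ₐ[K] B)
    (hπ : Function.Surjective π)
    (h : ∀ a, (∀ b, m * a * b * m ∈ cellIdeal X) ↔ ∀ b, m' * π a * b * m' ∈ cellIdeal X') :
    ∃ e : cellHead star hstar m X ≃+ cellHead star' hstar' m' X',
      ∀ a d, e (MulOpposite.op a • d) = MulOpposite.op (π a) • e d := by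
  let f : A →+ cellHead star hstar m X := (toCellHead star hstar m X).toAddMonoidHom
  let f' : A →+ cellHead star' hstar' m' X' :=
    (toCellHead star' hstar' m' X').toAddMonoidHom.comp (π : A →+ B)
  have hf : Function.Surjective f := toCellHead_surjective star hstar m X
  have hf' : Function.Surjective f' := (toCellHead_surjective star' hstar' m' X').comp hπ
  have hker : f.ker = f'.ker := by
    ext a
    exact (toCellHead_eq_zero_iff star hstar m X a).trans
      ((h a).trans (toCellHead_eq_zero_iff star' hstar' m' X' (π a)).symm)
  let e := (QuotientAddGroup.quotientKerEquivOfSurjective f hf).symm.trans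
    ((QuotientAddGroup.quotientAddEquivOfEq hker).trans
      (QuotientAddGroup.quotientKerEquivOfSurjective f' hf'))
  have he : ∀ a, e (f a) = f' a := by
    intro a
    have : (QuotientAddGroup.quotientKerEquivOfSurjective f hf).symm (f a) =
        (a : A ⧸ f.ker) := by
      rw [AddEquiv.symm_apply_eq]
      rfl
    simp only [e, AddEquiv.trans_apply, this]
    rfl
  refine ⟨e, fun a d => ?_⟩
  obtain ⟨b, rfl⟩ := hf d
  have h1 : MulOpposite.op a • f b = f (b * a) :=
    (map_smul (toCellHead star hstar m X) (MulOpposite.op a) b).symm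
  rw [h1, he, he]
  change toCellHead star' hstar' m' X' (π (b * a)) =
    MulOpposite.op (π a) • toCellHead star' hstar' m' X' (π b)
  rw [← map_smul, map_mul]
  rfl

end Cell

/-! ### Rows of Young diagrams -/

theorem exists_perm_comp_eq {ι γ : Type*} [Fintype ι] [DecidableEq γ] (f f' : ι → γ)
    (h : ∀ c, (Finset.univ.filter fun x => f' x = c).card =
      (Finset.univ.filter fun x => f x = c).card) :
    ∃ g : Equiv.Perm ι, ∀ x, f (g x) = f' x := by
  have e : ∀ c, Nonempty ({x // f' x = c} ≃ {x // f x = c}) := fun c =>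
    ⟨Fintype.equivOfCardEq (by rw [Fintype.card_subtype, Fintype.card_subtype, h])⟩
  refine ⟨(Equiv.sigmaFiberEquiv f').symm.trans ((Equiv.sigmaCongrRight fun c => (e c).some).trans
    (Equiv.sigmaFiberEquiv f)), fun x => ?_⟩
  exact ((e (f' x)).some ⟨x, rfl⟩).2

theorem card_filter_Ico_fin {n a b : ℕ} (hb : b ≤ n) :
    (Finset.univ.filter fun k : Fin n => a ≤ k.val ∧ k.val < b).card = b - a := by
  rw [← Nat.card_Ico, ← Finset.card_map Fin.valEmbedding]
  congr 1
  ext x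
  simp only [Finset.mem_map, Finset.mem_filter, Finset.mem_univ, true_and, Fin.valEmbedding_apply,
    Finset.mem_Ico]
  constructor
  · rintro ⟨k, hk, rfl⟩
    exact hk
  · intro hx
    exact ⟨⟨x, by omega⟩, hx, rfl⟩

namespace YoungDiagram

variable (α : YoungDiagram)

theorem rowSum_succ (j : ℕ) : rowSum α (j + 1) = rowSum α j + α.rowLen j :=
  Finset.sum_range_succ _ _

theorem rowSum_mono : Monotone (rowSum α) :=
  monotone_nat_of_le_succ fun j => by rw [rowSum_succ]; omega

theorem rowSum_eq_card (j : ℕ) : rowSum α j = (α.cells.filter fun x => x.1 < j).card := by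
  rw [Finset.card_eq_sum_card_fiberwise (f := Prod.fst) (t := Finset.range j)]
  · refine Finset.sum_congr rfl fun i hi => ?_
    rw [rowLen_eq_card, row, Finset.filter_filter]
    congr 1
    ext x
    simp only [Finset.mem_filter]
    have := Finset.mem_range.1 hi
    constructor
    · rintro ⟨h1, h2⟩
      exact ⟨h1, by omega, h2⟩
    · rintro ⟨h1, _, h2⟩
      exact ⟨h1, h2⟩
  · intro x hx
    simpa using (Finset.mem_filter.1 hx).2

theorem rowSum_le_card (j : ℕ) : rowSum α j ≤ α.card := by
  rw [rowSum_eq_card]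
  exact Finset.card_le_card (Finset.filter_subset _ _)

theorem exists_card_le_rowSum : ∃ j, α.card ≤ rowSum α j := by
  refine ⟨α.cells.sup Prod.fst + 1, ?_⟩
  rw [rowSum_eq_card, Finset.filter_true_of_mem]
  intro x hx
  exact Nat.lt_succ_of_le (Finset.le_sup (f := Prod.fst) hx)

theorem existsUnique_inRow {k : ℕ} (hk : k < α.card) : ∃ i, ∀ j, InRow α j k ↔ i = j := by
  -- The least such `j` is positive, and the row of `k` is its predecessor.
  have h : ∃ j, k < rowSum α j := by
    obtain ⟨j, hj⟩ := α.exists_card_le_rowSum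
    exact ⟨j, by omega⟩
  have h1 := Nat.find_spec h
  have h0 : Nat.find h ≠ 0 := by
    intro h0
    rw [h0] at h1
    simp [rowSum] at h1
  obtain ⟨i, hi⟩ := Nat.exists_eq_succ_of_ne_zero h0
  have h2 := Nat.find_min h (m := i) (by omega)
  rw [hi] at h1
  refine ⟨i, fun j => ⟨fun hj => ?_, ?_⟩⟩
  · by_contra hne
    rcases Nat.lt_or_gt_of_ne hne with hlt | hlt
    · have := rowSum_mono α (show i + 1 ≤ j from hlt)
      exact absurd hj.1 (by simp only [Nat.succ_eq_add_one] at h1; omega)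
    · have := rowSum_mono α (show j + 1 ≤ i from hlt)
      have := hj.2
      omega
  · rintro rfl
    exact ⟨by omega, h1⟩

/-- The row containing `k` in the initial tableau of shape `α`. -/
noncomputable def rowIdx {n : ℕ} (α : YPartition n) (k : Fin n) : ℕ :=
  (existsUnique_inRow α.1 (k.isLt.trans_eq α.2.symm)).choose

theorem inRow_iff {n : ℕ} (α : YPartition n) (k : Fin n) (j : ℕ) :
    InRow α.1 j k ↔ rowIdx α k = j :=
  (existsUnique_inRow α.1 (k.isLt.trans_eq α.2.symm)).choose_spec j

theorem card_rowIdx_eq {n : ℕ} (α : YPartition n) (j : ℕ) :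
    (Finset.univ.filter fun k => rowIdx α k = j).card = α.1.rowLen j := by
  simp only [← inRow_iff, InRow]
  rw [card_filter_Ico_fin ((rowSum_le_card _ _).trans_eq α.2), rowSum_succ, Nat.add_sub_cancel_left]

theorem mem_rowStab_iff {n : ℕ} (α : YPartition n) (w : Equiv.Perm (Fin n)) :
    w ∈ rowStab α ↔ ∀ k, rowIdx α (w k) = rowIdx α k := by
  simp only [rowStab, Finset.mem_filter, Finset.mem_univ, true_and, inRow_iff]
  constructor
  · intro h k
    exact h _ k rfl
  · rintro h i k rfl
    exact h k

/-- A Young diagram has a removable box at the end of the last row of a given length. -/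
theorem exists_removable {i : ℕ} (hi : 0 < α.rowLen i) :
    ∃ (β : YoungDiagram) (i' : ℕ), β.card + 1 = α.card ∧ α.rowLen i' = α.rowLen i ∧
      ∀ j, β.rowLen j = if j = i' then α.rowLen i - 1 else α.rowLen j := by
  set l := α.rowLen i with hl
  -- The bottom box of the column in which row `i` ends: `i'` is the last row of length `l`, so its
  -- end is removable.
  set i' := α.colLen (l - 1) - 1 with hi'
  have hcol : i < α.colLen (l - 1) := by
    rw [← mem_iff_lt_colLen, mem_iff_lt_rowLen]
    omega
  have hmem : (i', l - 1) ∈ α := by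
    rw [mem_iff_lt_colLen]
    omega
  have hrow : α.rowLen i' = l := by
    refine le_antisymm ?_ ?_
    · exact α.rowLen_anti i i' (by omega)
    · rw [mem_iff_lt_rowLen] at hmem
      omega
  have hnot : (i' + 1, l - 1) ∉ α := by
    rw [mem_iff_lt_colLen]
    omega
  let β : YoungDiagram :=
    { cells := α.cells.erase (i', l - 1)
      isLowerSet := by
        rintro ⟨a, b⟩ ⟨a', b'⟩ ⟨ha, hb⟩ h
        simp only [Finset.coe_erase, Set.mem_sdiff, Finset.mem_coe, Set.mem_singleton_iff] at h ⊢
        refine ⟨α.isLowerSet ⟨ha, hb⟩ h.1, fun h' => ?_⟩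
        obtain ⟨rfl, rfl⟩ := Prod.mk.inj h'
        simp only at ha hb
        have h1 : (a, b) ∈ α := h.1
        rcases ha.eq_or_lt with rfl | ha
        · rw [mem_iff_lt_rowLen, hrow] at h1
          exact h.2 (Prod.ext rfl (by simp only; omega))
        · exact hnot (α.up_left_mem ha hb h1) }
  refine ⟨β, i', Finset.card_erase_add_one hmem, hrow, fun j => ?_⟩
  have hb : ∀ b, b < β.rowLen j ↔ b < α.rowLen j ∧ ¬ (j = i' ∧ b = l - 1) := by
    intro b
    rw [← mem_iff_lt_rowLen, ← mem_iff_lt_rowLen]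
    change (j, b) ∈ α.cells.erase _ ↔ _
    rw [Finset.mem_erase, ne_eq, Prod.mk.injEq, and_comm]
    rfl
  refine eq_of_forall_lt_iff fun b => ?_
  rw [hb]
  split_ifs with h
  · subst h
    rw [hrow]
    omega
  · simp [h]

end YoungDiagram

/-! ### Multipartitions concentrated in the last component -/

theorem rowSum_bot (j : ℕ) : rowSum ⊥ j = 0 :=
  Nat.le_zero.1 ((YoungDiagram.rowSum_le_card ⊥ j).trans_eq (by simp))

theorem YoungDiagram.card_bot : (⊥ : YoungDiagram).card = 0 := rfl

/-- The multipartition `(∅, …, ∅, β)`. -/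
def concentrated {r n : ℕ} (hr : 0 < r) (β : YPartition n) : Multipartition r n :=
  ⟨fun i => if i.val + 1 = r then β.1 else ⊥, by
    rw [Finset.sum_eq_single (⟨r - 1, by omega⟩ : Fin r)]
    · simp only
      rw [if_pos (by omega), β.2]
    · intro i _ hi
      simp only
      rw [if_neg fun h => hi (Fin.ext (by simp only; omega)), YoungDiagram.card_bot]
    · exact fun h => absurd (Finset.mem_univ _) h⟩

section Concentrated

variable {r n : ℕ} (hr : 0 < r)

theorem concentrated_apply (β : YPartition n) (i : Fin r) :
    (concentrated hr β).1 i = if i.val + 1 = r then β.1 else ⊥ := rfl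

theorem boxesBefore_concentrated (β : YPartition n) (s : Fin r) :
    boxesBefore (concentrated hr β).1 s = 0 := by
  refine Finset.sum_eq_zero fun i hi => ?_
  have h : i.val < s.val := (Finset.mem_filter.1 hi).2
  rw [concentrated_apply, if_neg (by omega), YoungDiagram.card_bot]

theorem inMultiRow_concentrated (β : YPartition n) (s : Fin r) (i k : ℕ) :
    InMultiRow (concentrated hr β).1 s i k ↔ s.val + 1 = r ∧ InRow β.1 i k := by
  rw [InMultiRow, boxesBefore_concentrated, concentrated_apply, zero_add, zero_add]
  split_ifs with h
  · exact ⟨fun h' => ⟨h, h'⟩, fun h' => h'.2⟩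
  · rw [rowSum_bot, rowSum_bot]
    exact ⟨fun h' => absurd h'.2 (Nat.not_lt_zero _), fun h' => absurd h'.1 h⟩

theorem multiRowStab_concentrated (β : YPartition n) :
    multiRowStab (concentrated hr β) = rowStab β := by
  ext w
  simp only [multiRowStab, rowStab, Finset.mem_filter, Finset.mem_univ, true_and,
    inMultiRow_concentrated]
  exact ⟨fun h i k hk => (h ⟨r - 1, by omega⟩ i k ⟨by simp only; omega, hk⟩).2,
    fun h s i k hk => ⟨hk.1, h i k hk.2⟩⟩

theorem concentrated_injective : Function.Injective (concentrated (n := n) hr) := by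
  intro β β' h
  have := congrFun (congrArg Subtype.val h) (⟨r - 1, by omega⟩ : Fin r)
  rw [concentrated_apply, concentrated_apply, if_pos (by simp only; omega),
    if_pos (by simp only; omega)] at this
  exact Subtype.ext this

theorem multiDominates_concentrated (β α : YPartition n) :
    MultiDominates (concentrated hr β).1 (concentrated hr α).1 ↔ Dominates β.1 α.1 := by
  simp only [MultiDominates, boxesBefore_concentrated, zero_add, concentrated_apply]
  constructor
  · intro h j
    have := h ⟨r - 1, by omega⟩ j
    rwa [if_pos (by simp only; omega), if_pos (by simp only; omega)] at this
  · intro h s j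
    split_ifs
    · exact h j
    · exact le_rfl

/-- A multipartition is concentrated in its last component if no boxes come before it. -/
theorem eq_concentrated (mu : Multipartition r n)
    (h : boxesBefore mu.1 ⟨r - 1, by omega⟩ = 0) : ∃ β, mu = concentrated hr β := by
  have h0 : ∀ i : Fin r, i.val + 1 ≠ r → (mu.1 i).card = 0 := by
    intro i hi
    refine Finset.sum_eq_zero_iff.1 h i (Finset.mem_filter.2 ⟨Finset.mem_univ _, ?_⟩)
    rw [Fin.lt_def]
    simp only
    omega
  have hcard : (mu.1 ⟨r - 1, by omega⟩).card = n := by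
    refine (Finset.sum_eq_single (f := fun i => (mu.1 i).card) (⟨r - 1, by omega⟩ : Fin r)
      ?_ ?_).symm.trans mu.2
    · exact fun i _ hi => h0 i fun h' => hi (Fin.ext (by simp only; omega))
    · exact fun h => absurd (Finset.mem_univ _) h
  refine ⟨⟨_, hcard⟩, Subtype.ext (funext fun i => ?_)⟩
  rw [concentrated_apply]
  split_ifs with hi
  · have : i = ⟨r - 1, by omega⟩ := Fin.ext (by simp only; omega)
    rw [this]
  · have := Finset.card_eq_zero.1 (h0 i hi)
    ext x
    change x ∈ (mu.1 i).cells ↔ x ∈ (⊥ : YoungDiagram).cells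
    rw [this]
    rfl

end Concentrated

/-! ### Multipartitions with one box in the last but one component -/

/-- The Young diagram with one box. -/
def YoungDiagram.box : YoungDiagram where
  cells := {(0, 0)}
  isLowerSet := by
    rintro ⟨a, b⟩ ⟨a', b'⟩ ⟨ha, hb⟩ h
    simp only [Finset.coe_singleton, Set.mem_singleton_iff, Prod.mk.injEq] at h ha hb ⊢
    omega

theorem YoungDiagram.card_box : YoungDiagram.box.card = 1 := rfl

theorem rowSum_box (j : ℕ) : rowSum YoungDiagram.box j = if j = 0 then 0 else 1 := by
  rw [YoungDiagram.rowSum_eq_card, YoungDiagram.box, Finset.filter_singleton]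
  rcases j with _ | j <;> simp

/-- The multipartition `(∅, …, ∅, (1), β)`. -/
def boxAdded (r : ℕ) {n : ℕ} (β : YPartition n) : Multipartition (r + 2) (n + 1) :=
  ⟨fun i => if i.val = r + 1 then β.1 else if i.val = r then YoungDiagram.box else ⊥, by
    rw [Fin.sum_univ_castSucc, Fin.sum_univ_castSucc, Finset.sum_eq_zero]
    · have := β.2
      simp only [Fin.val_castSucc, Fin.val_last, Nat.succ_ne_self, if_true, if_false,
        show ¬ r = r + 1 by omega, YoungDiagram.card_box]
      omega
    · intro i _
      have := i.isLt
      simp only [Fin.val_castSucc]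
      rw [if_neg (by omega), if_neg (by omega), YoungDiagram.card_bot]⟩

section BoxAdded

variable {r n : ℕ} (β : YPartition n)

theorem boxAdded_apply (i : Fin (r + 2)) : (boxAdded r β).1 i =
    if i.val = r + 1 then β.1 else if i.val = r then YoungDiagram.box else ⊥ := rfl

theorem boxesBefore_boxAdded (s : Fin (r + 2)) :
    boxesBefore (boxAdded r β).1 s = if s.val = r + 1 then 1 else 0 := by
  split_ifs with h
  · rw [boxesBefore, Finset.sum_eq_single (⟨r, by omega⟩ : Fin (r + 2))]
    · rw [boxAdded_apply, if_neg (by simp), if_pos rfl, YoungDiagram.card_box]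
    · intro i hi hne
      have h' : i.val < s.val := (Finset.mem_filter.1 hi).2
      rw [boxAdded_apply, if_neg (by omega), if_neg fun h => hne (Fin.ext h),
        YoungDiagram.card_bot]
    · intro h'
      exact absurd (Finset.mem_filter.2 ⟨Finset.mem_univ _, by
        rw [Fin.lt_def]; simp only; omega⟩) h'
  · refine Finset.sum_eq_zero fun i hi => ?_
    have h' : i.val < s.val := (Finset.mem_filter.1 hi).2
    rw [boxAdded_apply, if_neg (by omega), if_neg (by omega), YoungDiagram.card_bot]

theorem inMultiRow_boxAdded (s : Fin (r + 2)) (i k : ℕ) :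
    InMultiRow (boxAdded r β).1 s i k ↔
      (s.val = r + 1 ∧ 0 < k ∧ InRow β.1 i (k - 1)) ∨ (s.val = r ∧ i = 0 ∧ k = 0) := by
  rw [InMultiRow, boxesBefore_boxAdded, boxAdded_apply, InRow]
  split_ifs with h h'
  · omega
  · rw [rowSum_box, rowSum_box]
    rw [if_neg (Nat.succ_ne_zero i)]
    split_ifs <;> omega
  · rw [rowSum_bot, rowSum_bot]
    omega

/-- The row of `k` in the initial tableau of shape `(∅, …, ∅, (1), β)`; `none` stands for the
box in the last but one component. -/
noncomputable def boxAddedRow (k : Fin (n + 1)) : Option ℕ :=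
  Fin.cases none (fun k => some (YoungDiagram.rowIdx β k)) k

theorem boxAddedRow_zero : boxAddedRow β 0 = none := rfl

theorem boxAddedRow_succ (k : Fin n) :
    boxAddedRow β k.succ = some (YoungDiagram.rowIdx β k) := rfl

theorem mem_multiRowStab_boxAdded_iff (w : Equiv.Perm (Fin (n + 1))) :
    w ∈ multiRowStab (boxAdded r β) ↔ ∀ k, boxAddedRow β (w k) = boxAddedRow β k := by
  simp only [multiRowStab, Finset.mem_filter, Finset.mem_univ, true_and, inMultiRow_boxAdded]
  have hr : ∀ (k : Fin (n + 1)) (i : ℕ), (0 < k.val ∧ InRow β.1 i (k.val - 1)) ↔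
      boxAddedRow β k = some i := by
    intro k i
    induction k using Fin.cases with
    | zero => simp [boxAddedRow_zero]
    | succ k =>
      rw [boxAddedRow_succ, Option.some_inj, ← YoungDiagram.inRow_iff]
      simp
  have hz : ∀ k : Fin (n + 1), k.val = 0 ↔ boxAddedRow β k = none := by
    intro k
    induction k using Fin.cases with
    | zero => simp [boxAddedRow_zero]
    | succ k => simp [boxAddedRow_succ]
  simp only [hr, hz]
  constructor
  · intro h k
    rcases hk : boxAddedRow β k with _ | i
    · have := h ⟨r, by omega⟩ 0 k (Or.inr ⟨rfl, rfl, hk⟩)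
      simpa using this
    · have := h ⟨r + 1, by omega⟩ i k (Or.inl ⟨rfl, hk⟩)
      simpa using this
  · intro h s i k hk
    rwa [h]

theorem card_boxAddedRow_none :
    (Finset.univ.filter fun k => boxAddedRow β k = none).card = 1 := by
  rw [Finset.card_eq_one]
  refine ⟨0, ?_⟩
  ext k
  induction k using Fin.cases with
  | zero => simp [boxAddedRow_zero]
  | succ k => simp [boxAddedRow_succ, Fin.succ_ne_zero]

theorem card_boxAddedRow_some (i : ℕ) :
    (Finset.univ.filter fun k => boxAddedRow β k = some i).card = β.1.rowLen i := by
  rw [← YoungDiagram.card_rowIdx_eq, ← Finset.card_map (Fin.succEmb n)]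
  congr 1
  ext k
  induction k using Fin.cases with
  | zero => simp [boxAddedRow_zero, Fin.succ_ne_zero]
  | succ k => simp [boxAddedRow_succ]

end BoxAdded

/-! ### Removing a point from the row stabilizer -/

/-- The stabilizer of a point `k` in the row stabilizer of the initial tableau of shape `α` is
conjugate to the row stabilizer of the initial tableau of shape `(∅, …, ∅, (1), β)`, where `β` is
obtained from `α` by removing a box. -/
theorem exists_conj_rowStab {r n : ℕ} (α : YPartition (n + 1)) (k : Fin (n + 1)) :
    ∃ (β : YPartition n) (g : Equiv.Perm (Fin (n + 1))),
      (∀ j, rowSum α.1 j ≤ rowSum β.1 j + 1) ∧ g 0 = k ∧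
      ∀ w, w ∈ multiRowStab (boxAdded r β) ↔ g * w * g⁻¹ ∈ rowStab α ∧ (g * w * g⁻¹) k = k := by
  classical
  set i := YoungDiagram.rowIdx α k with hi
  have hpos : 0 < α.1.rowLen i := by
    rw [← YoungDiagram.card_rowIdx_eq]
    exact Finset.card_pos.2 ⟨k, Finset.mem_filter.2 ⟨Finset.mem_univ _, rfl⟩⟩
  obtain ⟨β', i', hcard, hii', hβ⟩ := α.1.exists_removable hpos
  let β : YPartition n := ⟨β', by have := α.2; omega⟩
  have hsum : ∀ j, rowSum α.1 j = rowSum β' j + if i' < j then 1 else 0 := by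
    intro j
    induction j with
    | zero => simp [rowSum]
    | succ j ih =>
      rw [YoungDiagram.rowSum_succ, YoungDiagram.rowSum_succ, ih, hβ]
      have : j = i' → α.1.rowLen j = α.1.rowLen i := by rintro rfl; exact hii'
      split_ifs <;> omega
  -- Rows as labels, with a separate label for `k`. Removing `k` shortens row `i`, whereas `β` is
  -- shortened in the equally long row `i'`; exchanging these two labels makes the fibre sizes those
  -- of `(∅, …, ∅, (1), β)`.
  let f : Fin (n + 1) → Option ℕ := fun x =>
    if x = k then none else some (Equiv.swap i i' (YoungDiagram.rowIdx α x))
  have hf : ∀ w : Equiv.Perm (Fin (n + 1)),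
      (w ∈ rowStab α ∧ w k = k) ↔ ∀ x, f (w x) = f x := by
    intro w
    rw [YoungDiagram.mem_rowStab_iff]
    constructor
    · rintro ⟨h, hk⟩ x
      have : w x = k ↔ x = k := by
        conv_lhs => rw [← hk]
        exact EmbeddingLike.apply_eq_iff_eq _
      simp only [f, this, h]
    · intro h
      have hk : w k = k := by
        have := h k
        simp only [f, if_true] at this
        by_contra hne
        rw [if_neg hne] at this
        simp at this
      refine ⟨fun x => ?_, hk⟩
      have hx := h x
      by_cases hxk : x = k
      · rw [hxk, hk]
      · have : w x ≠ k := fun h' => hxk (w.injective (h'.trans hk.symm))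
        simp only [f, if_neg hxk, if_neg this, Option.some_inj, EmbeddingLike.apply_eq_iff_eq] at hx
        exact hx
  have hcards : ∀ c, (Finset.univ.filter fun x => boxAddedRow β x = c).card =
      (Finset.univ.filter fun x => f x = c).card := by
    intro c
    rcases c with _ | j
    · rw [card_boxAddedRow_none, eq_comm, Finset.card_eq_one]
      refine ⟨k, ?_⟩
      ext x
      simp [f]
    · rw [card_boxAddedRow_some]
      have : (Finset.univ.filter fun x => f x = some j) =
          (Finset.univ.filter fun x => YoungDiagram.rowIdx α x = Equiv.swap i i' j).erase k := by
        ext x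
        by_cases hx : x = k
        · simp [f, hx]
        · simp only [f, Finset.mem_filter, Finset.mem_univ, true_and, 
            Finset.mem_erase, ne_eq, hx, not_false_eq_true]
          rw [if_neg not_false, Option.some_inj, Equiv.swap_apply_eq_iff]
      rw [this, Finset.card_erase_eq_ite, YoungDiagram.card_rowIdx_eq]
      simp only [Finset.mem_filter, Finset.mem_univ, true_and, ← hi]
      have hβj := hβ j
      simp only [β]
      rw [hβj, Equiv.swap_apply_def]
      rcases eq_or_ne j i' with rfl | h2
      · rcases eq_or_ne j i with rfl | h1
        · simp
        · simp [h1]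
      · rcases eq_or_ne j i with rfl | h1
        · simp [h2, hii']
        · simp [h1, h2, h1.symm]
  obtain ⟨g, hg⟩ := exists_perm_comp_eq f (boxAddedRow β) hcards
  refine ⟨β, g, fun j => ?_, ?_, fun w => ?_⟩
  · rw [hsum j]
    simp only [β]
    split_ifs <;> omega
  · have := hg 0
    rw [boxAddedRow_zero] at this
    by_contra hne
    simp only [f, if_neg hne] at this
    simp at this
  · rw [hf, mem_multiRowStab_boxAdded_iff]
    constructor
    · intro h x
      rw [Equiv.Perm.mul_apply, Equiv.Perm.mul_apply, hg, h, ← hg,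
        show g (g⁻¹ x) = x from g.apply_symm_apply x]
    · intro h x
      have := h (g x)
      rwa [Equiv.Perm.mul_apply, Equiv.Perm.mul_apply,
        show g⁻¹ (g x) = x from g.symm_apply_apply x, hg, hg] at this

/-! ### Comparison of `D^λ` with `D^α` -/

namespace ArikiKoike

variable {K : Type*} [Field K] {r n : ℕ} {Q : Fin r → Kˣ} {c : K}

theorem xElt_eq_sum (lam : Multipartition r n) :
    xElt 1 Q lam = ∑ w ∈ multiRowStab lam, Tw 1 Q w := rfl

theorem sec_xElt (β : YPartition n) :
    sec Q n (SymGroupAlg.xElt K β) = ∑ w ∈ rowStab β, Tw 1 Q w := by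
  rw [SymGroupAlg.xElt, map_sum]
  exact Finset.sum_congr rfl fun w _ => sec_of w

theorem mElt_concentrated (hr : 0 < r) (β : YPartition n) :
    mElt 1 Q (concentrated hr β) = sec Q n (SymGroupAlg.xElt K β) := by
  have hu : uElt 1 Q (concentrated hr β) = 1 := by
    simp [uElt, boxesBefore_concentrated]
  rw [mElt, hu, one_mul, xElt_eq_sum, multiRowStab_concentrated, sec_xElt]

theorem mElt_boxAdded {Q : Fin (r + 2) → Kˣ} (hc : ∀ j, (Q j : K) = c) (β : YPartition n) :
    mElt 1 Q (boxAdded r β) =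
      nilJM Q c 0 * ∑ w ∈ multiRowStab (boxAdded r β), Tw 1 Q w := by
  have h1 : (List.finRange (n + 1)).filter (fun k => k.val < 1) = [0] := by
    rw [List.finRange_succ, List.filter_cons_of_pos (by simp), List.filter_eq_nil_iff.2]
    simp
  have key : ∀ s : Fin (r + 2), (((List.finRange (n + 1)).filter fun k =>
      k.val < boxesBefore (boxAdded r β).1 s).map fun k => jm 1 Q k.val k.isLt -
        algebraMap K (ArikiKoike 1 Q (n + 1)) (Q s : K)).prod =
      if s.val = r + 1 then nilJM Q c 0 else 1 := by
    intro s
    rw [boxesBefore_boxAdded]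
    split_ifs
    · rw [h1, List.map_singleton, List.prod_singleton, hc]
      rfl
    · simp
  have hu : uElt 1 Q (boxAdded r β) = nilJM Q c 0 := by
    have h0 : ∀ s : Fin (r + 1), s.val ≠ r + 1 := fun s => s.isLt.ne
    simp only [uElt, key]
    rw [List.finRange_succ_last]
    simp [Function.comp_def, h0]
  rw [mElt, hu, xElt_eq_sum]

/-- A box before the last component puts the factor `L_1 - Q_r = L_1 - c` into `u_μ`, and `proj`
kills it. -/
theorem proj_mElt_eq_zero (hr : 0 < r) (hc : ∀ j, (Q j : K) = c) (mu : Multipartition r n)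
    (h : boxesBefore mu.1 ⟨r - 1, by omega⟩ ≠ 0) : proj n hr hc (mElt 1 Q mu) = 0 := by
  have hn : 0 < n := by
    refine Nat.pos_of_ne_zero fun hn => h (Finset.sum_eq_zero fun i _ => ?_)
    exact Finset.sum_eq_zero_iff.1 (mu.2.trans hn) i (Finset.mem_univ _)
  rw [mElt, map_mul, uElt, map_list_prod, List.prod_eq_zero, zero_mul]
  refine List.mem_map.2 ⟨_, List.mem_map.2 ⟨⟨r - 1, by omega⟩, List.mem_finRange _, rfl⟩, ?_⟩
  rw [map_list_prod]
  refine List.prod_eq_zero (List.mem_map.2 ⟨_, List.mem_map.2 ⟨⟨0, hn⟩,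
    List.mem_filter.2 ⟨List.mem_finRange _, ?_⟩, rfl⟩, ?_⟩)
  · simpa using Nat.pos_of_ne_zero h
  · rw [hc]
    exact proj_nilJM hr hc ⟨0, hn⟩

/-- Each generator `m_μ` either dies or is concentrated in the last component, where it becomes
`x_β` with `β` strictly dominating `α`. -/
theorem proj_mem_cellIdeal (hr : 0 < r) (hc : ∀ j, (Q j : K) = c) (α : YPartition n)
    {a : ArikiKoike 1 Q n} (ha : a ∈ cellIdeal (above 1 Q (concentrated hr α))) :
    proj n hr hc a ∈ cellIdeal (SymGroupAlg.above K α) := by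
  induction ha using Submodule.span_induction with
  | zero => rw [map_zero]; exact zero_mem _
  | add x y _ _ hx hy => rw [map_add]; exact add_mem hx hy
  | smul b x _ hx =>
    have : proj n hr hc (b • x) = proj n hr hc x * proj n hr hc b.unop := map_mul _ x b.unop
    rw [this]
    exact mul_mem_cellIdeal_right hx _
  | mem x hx =>
    obtain ⟨a, _, ⟨mu, hdom, hne, rfl⟩, rfl⟩ := hx
    rw [map_mul]
    refine mul_mem_cellIdeal_left ?_ _
    by_cases h : boxesBefore mu.1 ⟨r - 1, by omega⟩ = 0
    · obtain ⟨β, rfl⟩ := eq_concentrated hr mu h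
      rw [mElt_concentrated, proj_sec]
      exact subset_cellIdeal ⟨β, (multiDominates_concentrated hr β α).1 hdom,
        fun h => hne (congrArg _ h), rfl⟩
    · rw [proj_mElt_eq_zero hr hc mu h]
      exact zero_mem _

theorem sec_mem_cellIdeal (hr : 0 < r) (α : YPartition n)
    {b : MonoidAlgebra K (Equiv.Perm (Fin n))} (hb : b ∈ cellIdeal (SymGroupAlg.above K α)) :
    sec Q n b ∈ cellIdeal (above 1 Q (concentrated hr α)) := by
  induction hb using Submodule.span_induction with
  | zero => rw [map_zero]; exact zero_mem _
  | add x y _ _ hx hy => rw [map_add]; exact add_mem hx hy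
  | smul b x _ hx =>
    have : sec Q n (b • x) = sec Q n x * sec Q n b.unop := map_mul _ x b.unop
    rw [this]
    exact mul_mem_cellIdeal_right hx _
  | mem x hx =>
    obtain ⟨b, _, ⟨β, hdom, hne, rfl⟩, rfl⟩ := hx
    rw [map_mul]
    refine mul_mem_cellIdeal_left ?_ _
    exact subset_cellIdeal ⟨concentrated hr β, (multiDominates_concentrated hr β α).2 hdom,
      fun h => hne (concentrated_injective hr h), (mElt_concentrated hr β).symm⟩

/-- A row stabilizer is a union of cosets of the stabilizer of `k` in it. -/
theorem sum_rowStab_mul_mem (α : YPartition n) (k : Fin n) (X : Set (ArikiKoike 1 Q n))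
    (a : ArikiKoike 1 Q n)
    (h : (∑ w ∈ (rowStab α).filter (fun w => w k = k), Tw 1 Q w) * a ∈ cellIdeal X) :
    (∑ w ∈ rowStab α, Tw 1 Q w) * a ∈ cellIdeal X := by
  rw [← Finset.sum_fiberwise (rowStab α) (fun w => w k), Finset.sum_mul]
  refine sum_mem fun j _ => ?_
  by_cases hj : ∃ t ∈ rowStab α, t k = j
  · obtain ⟨t, ht, rfl⟩ := hj
    -- The elements sending `k` to `t k` form the left coset of `t` modulo the stabilizer of `k`.
    have : ∑ w ∈ (rowStab α).filter (fun w => w k = t k), Tw 1 Q w =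
        Tw 1 Q t * ∑ w ∈ (rowStab α).filter (fun w => w k = k), Tw 1 Q w := by
      rw [Finset.mul_sum, eq_comm]
      refine Finset.sum_equiv (Equiv.mulLeft t) (fun w => ?_) fun w _ => (Tw_mul t w).symm
      rw [YoungDiagram.mem_rowStab_iff] at ht
      simp only [Finset.mem_filter, YoungDiagram.mem_rowStab_iff, Equiv.coe_mulLeft,
        Equiv.Perm.mul_apply, ht, EmbeddingLike.apply_eq_iff_eq]
    rw [this, mul_assoc]
    exact mul_mem_cellIdeal_left h _
  · rw [Finset.filter_false_of_mem fun w hw h' => hj ⟨w, hw, h'⟩, Finset.sum_empty, zero_mul]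
    exact zero_mem _

/-- By cosets it suffices to treat the sum over the stabilizer of `k` in the row stabilizer. That
sum commutes with `L_k - c`, and the product is conjugate to `(L_1 - c) x_μ = m_μ` for `μ = (∅, …,
∅, (1), β)`, a generator of the ideal. -/
theorem mElt_mul_nilJM_mem (hr : 0 < r) (hc : ∀ j, (Q j : K) = c) (α : YPartition n)
    (k : Fin n) : mElt 1 Q (concentrated hr α) * nilJM Q c k ∈
      cellIdeal (above 1 Q (concentrated hr α)) := by
  obtain ⟨n, rfl⟩ : ∃ m, n = m + 1 := ⟨n - 1, by have := k.isLt; omega⟩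
  -- For `r = 1` there is no last but one component, but `L_k - c` is already zero.
  rcases (show r = 1 ∨ 2 ≤ r by omega) with rfl | h2
  · have := nilJM_pow hc k
    rw [pow_one] at this
    rw [this, mul_zero]
    exact zero_mem _
  obtain ⟨r, rfl⟩ : ∃ s, r = s + 2 := ⟨r - 2, by omega⟩
  obtain ⟨β, g, hsum, hg0, hg⟩ := exists_conj_rowStab (r := r) α k
  rw [mElt_concentrated, sec_xElt]
  refine sum_rowStab_mul_mem α k _ _ ?_
  have hconj : (∑ w ∈ (rowStab α).filter (fun w => w k = k), Tw 1 Q w) * nilJM Q c k =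
      Tw 1 Q g * mElt 1 Q (boxAdded r β) * Tw 1 Q g⁻¹ := by
    rw [mElt_boxAdded hc, ← mul_assoc, Tw_mul_nilJM, hg0, mul_assoc, mul_assoc, Finset.sum_mul,
      Finset.sum_mul, Finset.mul_sum, Finset.mul_sum, eq_comm]
    refine Finset.sum_equiv (MulAut.conj g).toEquiv (fun w => ?_) fun w hw => ?_
    · rw [hg, Finset.mem_filter]
      rfl
    · change _ = Tw 1 Q (g * w * g⁻¹) * nilJM Q c k
      rw [Tw_mul_nilJM, ((hg w).1 hw).2, Tw_mul, Tw_mul, mul_assoc (Tw 1 Q g)]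
  rw [hconj]
  refine mul_mem_cellIdeal_right (mul_mem_cellIdeal_left ?_ _) _
  -- In the last component the box placed before it makes up for the one missing from `β`. The count
  -- of boxes before that component, one against zero, shows that the shapes differ.
  refine subset_cellIdeal ⟨boxAdded r β, fun s j => ?_, fun h => ?_, rfl⟩
  · rw [boxesBefore_concentrated, boxesBefore_boxAdded, concentrated_apply, boxAdded_apply]
    split_ifs with h1 h3
    · have := hsum j
      omega
    all_goals first | omega | (rw [rowSum_bot]; omega)
  · have := congrArg (fun mu => boxesBefore mu.1 (⟨r + 1, by omega⟩ : Fin (r + 2))) h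
    simp [boxesBefore_boxAdded, boxesBefore_concentrated] at this

theorem mElt_mul_mem_of_mem_nilIdeal (hr : 0 < r) (hc : ∀ j, (Q j : K) = c) (α : YPartition n)
    {a : ArikiKoike 1 Q n} (ha : a ∈ nilIdeal Q n c) :
    mElt 1 Q (concentrated hr α) * a ∈ cellIdeal (above 1 Q (concentrated hr α)) := by
  induction ha using Submodule.span_induction with
  | zero => rw [mul_zero]; exact zero_mem _
  | add x y _ _ hx hy => rw [mul_add]; exact add_mem hx hy
  | smul b x _ hx =>
    have : mElt 1 Q (concentrated hr α) * b • x =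
      (mElt 1 Q (concentrated hr α) * x) * b.unop := (mul_assoc _ _ _).symm
    rw [this]
    exact mul_mem_cellIdeal_right hx _
  | mem x hx =>
    obtain ⟨k, rfl⟩ := hx
    exact mElt_mul_nilJM_mem hr hc α k

/-- For `q = 1` and equal parameters, `D^λ` with `λ = (∅, …, ∅, α)` is the pullback of `D^α` along
the projection to the group algebra. -/
theorem exists_equiv_D (hr : 0 < r) (hc : ∀ j, (Q j : K) = c) (α : YPartition n)
    {lam : Multipartition r n} (hlam : lam = concentrated hr α) :
    ∃ e : D 1 Q lam ≃+ SymGroupAlg.D K α,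
      ∀ a d, e (MulOpposite.op a • d) = MulOpposite.op (proj n hr hc a) • e d := by
  subst hlam
  refine cellHead_equiv_of_proj _ _ _ _ _ _ _ _ (proj n hr hc) (proj_surjective hr hc) fun a => ?_
  rw [mElt_concentrated]
  constructor
  · intro h b
    have := proj_mem_cellIdeal hr hc α (h (sec Q n b))
    simpa only [map_mul, proj_sec] using this
  · intro h a'
    -- Here `m a a' m` splits into the lift of a group algebra element of the ideal and `m z m` with
    -- `z` in `nilIdeal`, for which already `m z` lies in the ideal.
    have h1 := sec_mem_cellIdeal (Q := Q) hr α (h (proj n hr hc a'))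
    have h2 := mul_mem_cellIdeal_right (mElt_mul_mem_of_mem_nilIdeal hr hc α
      (sub_sec_proj_mem hr hc (a * a'))) (mElt 1 Q (concentrated hr α))
    rw [mElt_concentrated] at h2
    have h3 := add_mem h1 h2
    simp only [map_mul] at h3
    convert h3 using 1
    noncomm_ring

end ArikiKoike

theorem mainTheorem8 {K : Type*} [Field K] {r n : ℕ} (hr : 0 < r) (hn : 0 < n)
    (Q : Fin r → Kˣ) (hQ : QConnected 1 Q)
    (lam : Multipartition r n) (α : YPartition n)
    (hlam : ∀ i : Fin r, lam.1 i = if i.val + 1 = r then α.1 else ⊥)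
    (hD : Nontrivial (ArikiKoike.D 1 Q lam))
    (t : ℕ)
    (ht : Module.length (MonoidAlgebra K (Equiv.Perm (Fin (n + 1))))ᵐᵒᵖ
      (SymGroupAlg.Ind K n (SymGroupAlg.D K α)) = t) :
    Module.length (ArikiKoike 1 Q (n + 1))ᵐᵒᵖ
        (ArikiKoike.Ind 1 Q n (ArikiKoike.D 1 Q lam)) = ((r * t : ℕ) : ℕ∞) ∧
      ∃ M : Fin (r + 1) → Submodule (ArikiKoike 1 Q (n + 1))ᵐᵒᵖ
          (ArikiKoike.Ind 1 Q n (ArikiKoike.D 1 Q lam)),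
        M 0 = ⊤ ∧ M (Fin.last r) = ⊥ ∧ StrictAnti M ∧
        (∀ i j : Fin r, Nonempty
          ((M i.castSucc ⧸ (M i.succ).submoduleOf (M i.castSucc))
            ≃ₗ[(ArikiKoike 1 Q (n + 1))ᵐᵒᵖ]
              (M j.castSucc ⧸ (M j.succ).submoduleOf (M j.castSucc)))) ∧
        ∀ i : Fin r, Module.length (ArikiKoike 1 Q (n + 1))ᵐᵒᵖ
          (M i.castSucc ⧸ (M i.succ).submoduleOf (M i.castSucc)) = t := by
  have hc : ∀ j, (Q j : K) = (Q ⟨0, hr⟩ : K) := by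
    intro j
    obtain ⟨k, hk⟩ := hQ j ⟨0, hr⟩
    rw [hk, one_zpow, one_mul]
  obtain ⟨e, he⟩ := ArikiKoike.exists_equiv_D hr hc α
    (Subtype.ext (funext hlam) : lam = concentrated hr α)
  exact ArikiKoike.ind_layers hr e he hD ht
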